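/- Let $m>0$ and $n\in\{2,3\}$, and let $k\in\mathbb Z$ if $n=2$, $k\in\mathbb Z\setminus\{0\}$ if $n=3$. Write $\operatorname{sgn}(k)=1$ for $k\ge 0$ and $-1$ for $k<0$. Let $J_\nu$ be the Bessel function of the first kind and, for $|E|>m$, $$p=\sqrt{E^2-m^2},\qquad N^{\pm}(E)=\sqrt{\frac{E\pm m}{2E}}=\sqrt{\frac{|E|\pm \operatorname{sgn}(E)\,m}{2|E|}} .$$ Let $\nu^+=|k|$, $\nu^-=|k|+\operatorname{sgn}(k)$ if $n=2$, and $\nu^+=|k|+\tfrac12\operatorname{sgn}(k)$, $\nu^-=|k|-\tfrac12\operatorname{sgn}(k)$ if $n=3$; put $s=\nu^--\nu^+\in\{1,-1\}$. For $r>0$ let $\psi_k=(F_k,G_k)^T$ with $$F_k(E,r)=r^{-\frac{n-2}{2}}N^+(E)\,J_{\nu^+}(pr),\qquad G_k(E,r)=-i\,s\,\operatorname{sgn}(E)\,r^{-\frac{n-2}{2}}N^-(E)\,J_{\nu^-}(pr).$$ For $f=(f_1,f_2)\in[L^2((0,\infty),r^{n-1}dr)]^2$, with $\|f\|^2=\int_0^\infty(|f_1|^2+|f_2|^2)\,r^{n-1}dr$,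 put $$\mathcal P_kf(E)=\int_0^{\infty}\psi_k(E,r)^T f(r)\,r^{n-1}dr=\int_0^\infty\big(F_k(E,r)f_1(r)+G_k(E,r)f_2(r)\big)r^{n-1}dr ,$$ understood as the limit of $\int_0^R$ in $L^2(\mathbb R\setminus[-m,m],|E|\,dE)$ as $R\to\infty$. Let $d_k$ be the radial Dirac operator $$d_k=\begin{pmatrix} m & -i\left(\frac{d}{dr}+\frac{k+1}{r}\right)\\ -i\left(\frac{d}{dr}-\frac{k}{r}\right) & -m\end{pmatrix}\ (n=2),\qquad d_k=\begin{pmatrix} m & -i\left(\frac{d}{dr}-\frac{k-1}{r}\right)\\ -i\left(\frac{d}{dr}+\frac{k+1}{r}\right) & -m\end{pmatrix}\ (n=3),$$ whose domain consists of the $f\in[L^2((0,\infty),r^{n-1}dr)]^2$ with components weakly differentiable on $(0,\infty)$ and $d_kf\in[L^2((0,\infty),r^{n-1}dr)]^2$. **Proposition.** For each such $n$ and $k$, for every $f$ and every $R$ the truncated integral $\int_0^R\psi_k(E,r)^Tf(r)r^{n-1}dr$ converges absolutely for each $|E|>m$ and lies in $L^2(\mathbb R\setminus[-m,m],|E|\,dE)$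 as a function of $E$; the limit defining $\mathcal P_kf$ exists; and the following hold. 1. $\mathcal P_k:[L^2((0,\infty),r^{n-1}dr)]^2\to L^2(\mathbb R\setminus[-m,m],|E|\,dE)$ is linear and invertible, and its inverse is $$\mathcal P_k^{-1}\phi(r)=\int_{\mathbb R\setminus[-m,m]}\begin{pmatrix}\overline{F_k(E,r)}\\ \overline{G_k(E,r)}\end{pmatrix}\phi(E)\,|E|\,dE ,$$ understood as the limit in $[L^2((0,\infty),r^{n-1}dr)]^2$, as $R\to\infty$, of the integrals over $m<|E|\le R$, which converge absolutely for every $r>0$ and lie in that space. 2. $\mathcal P_k$ is an isometry. 3. For every $f$ in the domain of $d_k$, $(\mathcal P_k d_kf)(E)=E\,\mathcal P_kf(E)$ for almost every $E$ with $|E|>m$. -/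

import Mathlib

open MeasureTheory Set Filter Topology
open scoped ENNReal ContDiff

noncomputable section

namespace RelHankel

/-- The Bessel function of the first kind of real order `ν` at `x ≥ 0`,
`J_ν(x) = ∑_j (-1)^j / (j! Γ(j+ν+1)) (x/2)^(2j+ν)`. -/
def besselJ (ν x : ℝ) : ℝ :=
  ∑' j : ℕ, (-1) ^ j / ((j.factorial : ℝ) * Real.Gamma (j + ν + 1)) * (x / 2) ^ (2 * j + ν)

/-- The sign of the partial wave index, with the convention `sgn 0 = 1`. -/
def sgnIdx (k : ℤ) : ℝ := if 0 ≤ k then 1 else -1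

/-- Order of the Bessel function in the upper component: `|k|` for `n = 2`,
`|k| + sgn(k)/2` for `n = 3`. -/
def upperOrder (n : ℕ) (k : ℤ) : ℝ :=
  if n = 2 then |(k : ℝ)| else |(k : ℝ)| + sgnIdx k / 2

/-- Order of the Bessel function in the lower component: `|k| + sgn(k)` for `n = 2`,
`|k| - sgn(k)/2` for `n = 3`. -/
def lowerOrder (n : ℕ) (k : ℤ) : ℝ :=
  if n = 2 then |(k : ℝ)| + sgnIdx k else |(k : ℝ)| - sgnIdx k / 2

/-- The momentum `p = √(E² - m²)`. -/
def momentum (m E : ℝ) : ℝ := √(E ^ 2 - m ^ 2)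

/-- `N⁺(E) = √((E + m) / (2E))`, that is `√((|E| + sgn(E) m) / (2|E|))`. -/
def normPlus (m E : ℝ) : ℝ := √((E + m) / (2 * E))

/-- `N⁻(E) = √((E - m) / (2E))`, that is `√((|E| - sgn(E) m) / (2|E|))`. -/
def normMinus (m E : ℝ) : ℝ := √((E - m) / (2 * E))

/-- Upper component `F_k(E, r) = r^(-(n-2)/2) N⁺(E) J(p r)`. -/
def upperWave (n : ℕ) (k : ℤ) (m E r : ℝ) : ℂ :=
  ((r ^ ((2 - (n : ℝ)) / 2) * normPlus m E *
    besselJ (upperOrder n k) (momentum m E * r) : ℝ) : ℂ)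

/-- Lower component `G_k(E, r) = -i s sgn(E) r^(-(n-2)/2) N⁻(E) J(p r)`, where `s = ±1` is the
difference of the orders of the lower and of the upper Bessel function. -/
def lowerWave (n : ℕ) (k : ℤ) (m E r : ℝ) : ℂ :=
  -Complex.I * (((lowerOrder n k - upperOrder n k) * Real.sign E *
    r ^ ((2 - (n : ℝ)) / 2) * normMinus m E *
    besselJ (lowerOrder n k) (momentum m E * r) : ℝ) : ℂ)

/-- The measure `r^(n-1) dr` on `(0, ∞)`. -/
def radialMeasure (n : ℕ) : Measure ℝ :=
  (volume.restrict (Ioi 0)).withDensity fun r => ENNReal.ofReal (r ^ (n - 1))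

/-- The measure `|E| dE` on `ℝ ∖ [-m, m]`. -/
def energyMeasure (m : ℝ) : Measure ℝ :=
  (volume.restrict (Icc (-m) m)ᶜ).withDensity fun E => ENNReal.ofReal |E|

/-- `[L²((0, ∞), r^(n-1) dr)]²`, with `‖f‖² = ∫ (|f₁|² + |f₂|²) r^(n-1) dr`. -/
abbrev RadialL2 (n : ℕ) : Type := Lp (EuclideanSpace ℂ (Fin 2)) 2 (radialMeasure n)

/-- `L²(ℝ ∖ [-m, m], |E| dE)`. -/
abbrev EnergyL2 (m : ℝ) : Type := Lp ℂ 2 (energyMeasure m)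

/-- The integrand `ψ_k(E, r)ᵀ f(r)` of the transform (no complex conjugation). -/
def integrand (n : ℕ) (k : ℤ) (m : ℝ) (f : ℝ → EuclideanSpace ℂ (Fin 2)) (E r : ℝ) : ℂ :=
  upperWave n k m E r * f r 0 + lowerWave n k m E r * f r 1

/-- `∫_0^R ψ_k(E, r)ᵀ f(r) r^(n-1) dr`. -/
def truncTransform (n : ℕ) (k : ℤ) (m R : ℝ) (f : ℝ → EuclideanSpace ℂ (Fin 2)) (E : ℝ) : ℂ :=
  ∫ r in Ioc 0 R, integrand n k m f E r ∂(radialMeasure n)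

/-- The integrand `(conj F_k(E, r), conj G_k(E, r)) φ(E)` of the inverse transform. -/
def invIntegrand (n : ℕ) (k : ℤ) (m : ℝ) (φ : ℝ → ℂ) (r E : ℝ) : EuclideanSpace ℂ (Fin 2) :=
  !₂[star (upperWave n k m E r) * φ E, star (lowerWave n k m E r) * φ E]

/-- `∫_{m < |E| ≤ R} (conj F_k(E, r), conj G_k(E, r)) φ(E) |E| dE`. -/
def truncInverse (n : ℕ) (k : ℤ) (m R : ℝ) (φ : ℝ → ℂ) (r : ℝ) : EuclideanSpace ℂ (Fin 2) :=
  ∫ E in Icc (-R) R, invIntegrand n k m φ r E ∂(energyMeasure m)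

/-- `v` is the weak derivative of `u` on `(0, ∞)`. -/
def HasWeakDeriv (u v : ℝ → ℂ) : Prop :=
  LocallyIntegrableOn u (Ioi 0) ∧ LocallyIntegrableOn v (Ioi 0) ∧
    ∀ η : ℝ → ℝ, ContDiff ℝ ∞ η → HasCompactSupport η → tsupport η ⊆ Ioi 0 →
      ∫ r in Ioi (0 : ℝ), deriv η r • u r = -∫ r in Ioi (0 : ℝ), η r • v r

/-- Coefficient `a` of the entry `-i (d/dr + a / r)`, from the lower to the upper component:
`k + 1` for `n = 2` and `-(k - 1)` for `n = 3`. -/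
def lowerToUpper (n : ℕ) (k : ℤ) : ℂ := if n = 2 then (k : ℂ) + 1 else 1 - (k : ℂ)

/-- Coefficient `b` of the entry `-i (d/dr + b / r)`, from the upper to the lower component:
`-k` for `n = 2` and `k + 1` for `n = 3`. -/
def upperToLower (n : ℕ) (k : ℤ) : ℂ := if n = 2 then -(k : ℂ) else (k : ℂ) + 1

/-- `f` lies in the domain of the radial Dirac operator and `g = d_k f`: both are spinors of
`[L²(r^(n-1) dr)]²`, the components of `f` are weakly differentiable on `(0, ∞)`, and
`g₁ = m f₁ - i (f₂' + a f₂ / r)`, `g₂ = -i (f₁' + b f₁ / r) - m f₂`. For the partial waves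
considered here this maximal domain is the domain of self-adjointness. -/
def IsRadialDirac (n : ℕ) (k : ℤ) (m : ℝ) (f g : RadialL2 n) : Prop :=
  ∃ u v : ℝ → ℂ, HasWeakDeriv (fun r => f r 0) u ∧ HasWeakDeriv (fun r => f r 1) v ∧
    ∀ᵐ r ∂(radialMeasure n),
      g r 0 = (m : ℂ) * f r 0 - Complex.I * (v r + lowerToUpper n k / (r : ℂ) * f r 1) ∧
      g r 1 = -Complex.I * (u r + upperToLower n k / (r : ℂ) * f r 0) - (m : ℂ) * f r 1

end RelHankel

end

open RelHankel

noncomputable section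

namespace RelHankel

/-! Everything is tested on modulated Gaussians `r^ν exp(-t r²/2)` placed in a single component. By
Weber's integral (`integral_besselJ_mul_gaussian`) the Hankel transform of order `ν` sends such a
Gaussian to `t^(-ν-1) p^ν exp(-p²/(2t))`, so both sides of the transform are explicit. The energies
`±E` share one momentum `p`, the measure `|E| dE` becomes twice `p dp`, and the amplitude vectors at
`E` and `-E` form an orthonormal basis of `ℂ²`. The energy space is therefore two copies of `L²(p
dp)`, one for each component.

The radial Gaussians and their transforms are both total, because after the substitution `y = p²/2`
orthogonality to all of them says that a Laplace transform vanishes. They have the same Gram matrix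
by `gaussMoment_inv_add_inv`. Hence a unitary `P` matches the two families (`exists_unitary`), and
neither Bessel asymptotics nor a Hankel inversion theorem is needed.

It remains to recognise `P` and its inverse as the stated integrals. On truncated functions the
crude growth bound of the power series of `J` is enough for Fubini against Gaussians of parameter
larger than `R²/2`. Since the Laplace transform is determined by its values at large parameters,
this identifies the truncated integrals (`truncWave_ae_eq`, `integral_star_wave_mul_ae_eq`). The
isometry then lets `R → ∞`.

For the Dirac operator, `d_k f` is paired with a Gaussian and integrated by parts
(`integral_gaussian_mul_weakDeriv`). The derivative moves a Gaussian of one order to the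
neighbouring order (`integral_offDiag`), while on the energy side the amplitudes are eigenvectors of
the symbol (`energy_mul_star_amplitude`). A logarithmic cutoff removes the boundary terms, including
the borderline order `0`. -/

/-! ### Gaussians on the half-line and their moments. -/

/-- The Gaussian moment `∫_0^∞ x^(2ν+1) exp(-a x²/2) dx`, see `integral_rpow_mul_gaussian`. -/
def gaussMoment (ν a : ℝ) : ℝ := 2 ^ ν * Real.Gamma (ν + 1) * a ^ (-ν - 1)

/-- The modulated Gaussian `x^ν exp(-t x²/2)`. -/
def gaussian (ν t x : ℝ) : ℝ := x ^ ν * Real.exp (-(t * x ^ 2 / 2))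

lemma measurable_gaussian (ν t : ℝ) : Measurable (gaussian ν t) := by
  unfold gaussian; fun_prop

lemma gaussian_nonneg {ν t x : ℝ} (hx : 0 ≤ x) : 0 ≤ gaussian ν t x := by
  unfold gaussian; positivity

lemma gaussian_mul_gaussian {ν ν' t t' x : ℝ} (hx : 0 < x) :
    gaussian ν t x * gaussian ν' t' x = gaussian (ν + ν') (t + t') x := by
  unfold gaussian
  rw [Real.rpow_add hx, mul_mul_mul_comm, ← Real.exp_add]
  congr 2; ring

lemma rpow_mul_gaussian {a ν t x : ℝ} (hx : 0 < x) :
    x ^ a * gaussian ν t x = gaussian (a + ν) t x := by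
  unfold gaussian
  rw [Real.rpow_add hx, mul_assoc]

lemma integrableOn_gaussian {q a : ℝ} (hq : -1 < q) (ha : 0 < a) :
    IntegrableOn (gaussian q a) (Ioi 0) := by
  refine (integrableOn_rpow_mul_exp_neg_mul_sq (b := a / 2) (by positivity) hq).congr_fun
    (fun x _ => ?_) measurableSet_Ioi
  simp only [gaussian]; congr 2; ring

lemma integral_gaussian {ν a : ℝ} (hν : -1 < ν) (ha : 0 < a) :
    ∫ x in Ioi (0 : ℝ), gaussian (2 * ν + 1) a x = gaussMoment ν a := by
  have h := integral_rpow_mul_exp_neg_mul_rpow (p := 2) (q := 2 * ν + 1) (b := a / 2) two_pos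
    (by linarith) (by positivity)
  have h2 : ∫ x in Ioi (0 : ℝ), gaussian (2 * ν + 1) a x
      = ∫ x in Ioi (0 : ℝ), x ^ (2 * ν + 1) * Real.exp (-(a / 2) * x ^ (2 : ℝ)) := by
    refine setIntegral_congr_fun measurableSet_Ioi (fun x _ => ?_)
    simp only [gaussian, Real.rpow_two]; congr 2; ring
  rw [h2, h, gaussMoment]
  have e1 : (2 * ν + 1 + 1) / 2 = ν + 1 := by ring
  have e2 : -(2 * ν + 1 + 1) / 2 = -ν - 1 := by ring
  rw [e1, e2, Real.div_rpow ha.le two_pos.le]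
  have : (2 : ℝ) ^ (-ν - 1) = (2 ^ ν * 2)⁻¹ := by
    rw [← Real.rpow_add_one two_ne_zero, ← Real.rpow_neg two_pos.le]; congr 1; ring
  rw [this]
  have : (2 : ℝ) ^ ν ≠ 0 := by positivity
  field_simp

/-- The recurrence of the Gamma function in disguise. It produces the cancellation in
`integral_ladder`. -/
lemma gaussMoment_sub_one {ν a : ℝ} (hν : 0 < ν) (ha : 0 < a) :
    2 * ν * gaussMoment (ν - 1) a = a * gaussMoment ν a := by
  unfold gaussMoment
  rw [Real.Gamma_add_one hν.ne', sub_add_cancel, Real.rpow_sub_one two_ne_zero,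
    show -(ν - 1) - 1 = -ν - 1 + 1 by ring, Real.rpow_add_one ha.ne']
  field_simp

/-- Gaussian moments at harmonic sums, the identity behind the unitarity of the transform. -/
lemma gaussMoment_inv_add_inv {ν t u : ℝ} (ht : 0 < t) (hu : 0 < u) :
    t ^ (-ν - 1) * u ^ (-ν - 1) * gaussMoment ν (t⁻¹ + u⁻¹) = gaussMoment ν (t + u) := by
  unfold gaussMoment
  have h : t⁻¹ + u⁻¹ = (t + u) * (t * u)⁻¹ := by field_simp; ring
  rw [h, Real.mul_rpow (by positivity) (by positivity), Real.inv_rpow (by positivity),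
    Real.mul_rpow ht.le hu.le]
  have := Real.rpow_pos_of_pos ht (-ν - 1)
  have := Real.rpow_pos_of_pos hu (-ν - 1)
  field_simp

/-! ### Growth of the Bessel series and Weber's integral. -/

lemma Gamma_le_Gamma_natCast_add {ν : ℝ} (hν : 0 ≤ ν) (j : ℕ) :
    Real.Gamma (ν + 1) ≤ Real.Gamma (j + ν + 1) := by
  induction j with
  | zero => simp
  | succ j ih =>
    have e : ((j + 1 : ℕ) : ℝ) + ν + 1 = (j + ν + 1) + 1 := by push_cast; ring
    have hj : (0 : ℝ) ≤ j := by positivity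
    rw [e, Real.Gamma_add_one (s := j + ν + 1) (by positivity)]
    refine ih.trans (le_mul_of_one_le_left (Real.Gamma_pos_of_pos (by positivity)).le ?_)
    linarith

/-- Replacing `Γ(j+ν+1)` by the smaller `Γ(ν+1)` leaves a multiple of the exponential series at
`x²/4`. -/
lemma besselJ_term_norm_le {ν x : ℝ} (hν : 0 ≤ ν) (hx : 0 ≤ x) (j : ℕ) :
    ‖(-1) ^ j / ((j.factorial : ℝ) * Real.Gamma (j + ν + 1)) * (x / 2) ^ (2 * j + ν)‖ ≤
      (x / 2) ^ ν / Real.Gamma (ν + 1) * ((x ^ 2 / 4) ^ j / j.factorial) := by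
  have hG := Real.Gamma_pos_of_pos (show 0 < ν + 1 by positivity)
  have hG2 := hG.trans_le (Gamma_le_Gamma_natCast_add hν j)
  have hf : (0 : ℝ) < j.factorial := by positivity
  rw [norm_mul, norm_div, norm_pow, norm_neg, norm_one, one_pow, Real.norm_of_nonneg
    (by positivity : (0 : ℝ) ≤ (j.factorial : ℝ) * Real.Gamma (j + ν + 1)),
    Real.norm_of_nonneg (by positivity), Real.rpow_add_of_nonneg (by positivity) (by positivity) hν]
  have e : (x / 2) ^ (2 * (j : ℝ)) = (x ^ 2 / 4) ^ j := by
    rw [Real.rpow_mul (by positivity), Real.rpow_natCast, Real.rpow_two]; congr 1; ring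
  rw [e]
  calc 1 / ((j.factorial : ℝ) * Real.Gamma (j + ν + 1)) * ((x ^ 2 / 4) ^ j * (x / 2) ^ ν)
      ≤ 1 / ((j.factorial : ℝ) * Real.Gamma (ν + 1)) * ((x ^ 2 / 4) ^ j * (x / 2) ^ ν) := by
        gcongr
        exact Gamma_le_Gamma_natCast_add hν j
    _ = _ := by field_simp

lemma summable_besselJ_bound (ν x : ℝ) :
    Summable fun j : ℕ => (x / 2) ^ ν / Real.Gamma (ν + 1) * ((x ^ 2 / 4) ^ j / j.factorial) :=
  (Real.summable_pow_div_factorial _).mul_left _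

/-- Far from sharp for large `x`, but the Bessel function is only ever paired with Gaussians whose
parameter can be taken large. -/
lemma abs_besselJ_le {ν x : ℝ} (hν : 0 ≤ ν) (hx : 0 ≤ x) :
    |besselJ ν x| ≤ (x / 2) ^ ν / Real.Gamma (ν + 1) * Real.exp (x ^ 2 / 4) := by
  have h := tsum_of_norm_bounded (summable_besselJ_bound ν x).hasSum
    (besselJ_term_norm_le hν hx)
  rw [tsum_mul_left] at h
  rwa [Real.exp_eq_exp_ℝ, NormedSpace.exp_eq_tsum_div]

lemma measurable_besselJ (ν : ℝ) : Measurable (besselJ ν) := by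
  unfold besselJ
  exact Measurable.tsum fun j => by fun_prop

lemma integrableOn_gaussian_two_mul {ν a : ℝ} (hν : -1 < ν) (ha : 0 < a) :
    IntegrableOn (gaussian (2 * ν + 1) a) (Ioi 0) :=
  integrableOn_gaussian (by linarith) ha

/-- Weber's integral: the Hankel transform of order `ν` of `x^ν exp(-τ x²/2)`. -/
theorem integral_besselJ_mul_gaussian {ν τ r : ℝ} (hν : 0 ≤ ν) (hτ : 0 < τ) (hr : 0 < r) :
    ∫ x in Ioi (0 : ℝ), besselJ ν (x * r) * gaussian (ν + 1) τ x =
      τ ^ (-ν - 1) * gaussian ν τ⁻¹ r := by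
  set F : ℕ → ℝ → ℝ := fun j x => (-1) ^ j / ((j.factorial : ℝ) * Real.Gamma (j + ν + 1)) *
    (x * r / 2) ^ (2 * j + ν) * gaussian (ν + 1) τ x with hF
  set c : ℕ → ℝ := fun j => (-1) ^ j / ((j.factorial : ℝ) * Real.Gamma (j + ν + 1)) *
    (r / 2) ^ (2 * j + ν) with hc
  have hFc : ∀ j, ∀ x ∈ Ioi (0 : ℝ), F j x = c j * gaussian (2 * (j + ν) + 1) τ x := by
    intro j x hx
    have hx : 0 < x := hx
    rw [hF, hc]
    simp only
    have e : gaussian (2 * ((j : ℝ) + ν) + 1) τ x = x ^ (2 * j + ν) * gaussian (ν + 1) τ x := by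
      rw [rpow_mul_gaussian hx]; congr 1; ring
    rw [mul_div_assoc, Real.mul_rpow hx.le (by positivity), e]
    ac_rfl
  have hjν : ∀ j : ℕ, (-1 : ℝ) < j + ν := fun j => by
    have : (0 : ℝ) ≤ j := by positivity
    linarith
  have hI : ∀ j, IntegrableOn (F j) (Ioi 0) := fun j =>
    IntegrableOn.congr_fun ((integrableOn_gaussian_two_mul (hjν j) hτ).const_mul (c j))
      (fun x hx => (hFc j x hx).symm) measurableSet_Ioi
  -- Integrated term by term, the Bessel series becomes the exponential series at `-X`.
  set X : ℝ := r ^ 2 / (2 * τ) with hX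
  have hval : ∀ j, c j * gaussMoment (j + ν) τ = τ ^ (-ν - 1) * r ^ ν * ((-X) ^ j / j.factorial) := by
    intro j
    have hG := (Real.Gamma_pos_of_pos (show 0 < ν + 1 by positivity)).trans_le
      (Gamma_le_Gamma_natCast_add hν j)
    have e1 : (r / 2) ^ (2 * (j : ℝ) + ν) = (r ^ 2 / 4) ^ j * r ^ ν / 2 ^ ν := by
      rw [Real.rpow_add (by positivity), Real.rpow_mul (by positivity), Real.rpow_natCast,
        Real.rpow_two, Real.div_rpow hr.le two_pos.le, mul_div_assoc]; congr 2; ring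
    have e2 : (2 : ℝ) ^ ((j : ℝ) + ν) = 2 ^ j * 2 ^ ν := by
      rw [Real.rpow_add two_pos, Real.rpow_natCast]
    have e3 : τ ^ (-((j : ℝ) + ν) - 1) = τ ^ (-ν - 1) / τ ^ j := by
      rw [← Real.rpow_natCast, ← Real.rpow_sub hτ]; congr 1; ring
    have h2 : (2 : ℝ) ^ ν ≠ 0 := by positivity
    have e4 : (-X) ^ j = (-1) ^ j * ((r ^ 2 / 4) ^ j * 2 ^ j / τ ^ j) := by
      rw [← mul_pow, ← div_pow, ← mul_pow, hX]; congr 1; field_simp; ring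
    simp only [hc, gaussMoment]
    rw [e1, e2, e3, e4]
    field_simp
  have hint : ∀ j, ∫ x in Ioi (0 : ℝ), F j x = τ ^ (-ν - 1) * r ^ ν * ((-X) ^ j / j.factorial) := by
    intro j
    rw [setIntegral_congr_fun measurableSet_Ioi (hFc j), integral_const_mul,
      integral_gaussian (hjν j) hτ, hval]
  -- Each term has constant sign in `x`, so the norm passes through the integral and absolute
  -- summability is that of the exponential series.
  have hnorm : ∀ j, ∫ x in Ioi (0 : ℝ), ‖F j x‖ =
      ‖τ ^ (-ν - 1) * r ^ ν * ((-X) ^ j / j.factorial)‖ := by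
    intro j
    rw [← hval, norm_mul, ← integral_gaussian (hjν j) hτ, Real.norm_of_nonneg (setIntegral_nonneg
      measurableSet_Ioi fun x hx => gaussian_nonneg (le_of_lt hx)), ← integral_const_mul]
    refine setIntegral_congr_fun measurableSet_Ioi fun x hx => ?_
    rw [hFc j x hx, norm_mul, Real.norm_of_nonneg (gaussian_nonneg (le_of_lt hx))]
  have hsum : Summable fun j => ∫ x in Ioi (0 : ℝ), ‖F j x‖ := by
    simp_rw [hnorm]
    exact ((Real.summable_pow_div_factorial (-X)).mul_left _).norm
  have key := integral_tsum_of_summable_integral_norm hI hsum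
  simp_rw [hint] at key
  rw [tsum_mul_left, ← congrFun NormedSpace.exp_eq_tsum_div, ← congrFun Real.exp_eq_exp_ℝ] at key
  calc ∫ x in Ioi (0 : ℝ), besselJ ν (x * r) * gaussian (ν + 1) τ x
      = ∫ x in Ioi (0 : ℝ), ∑' j, F j x := by
        refine setIntegral_congr_fun measurableSet_Ioi fun x _ => ?_
        simp only [besselJ, hF, tsum_mul_right]
    _ = _ := by
        rw [← key, gaussian, hX, mul_assoc]
        congr 3; field_simp

/-! ### Uniqueness of the Laplace transform from large parameters. -/

/-- Uniqueness of the Laplace transform, real-valued case. -/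
lemma ae_eq_zero_of_laplace_real {κ : Measure ℝ} {H : ℝ → ℝ} (hH : Measurable H) {t₀ : ℝ}
    (hint : ∀ t, t₀ ≤ t → Integrable (fun y => H y * Real.exp (-(t * y))) κ)
    (hzero : ∀ t, t₀ ≤ t → ∫ y, H y * Real.exp (-(t * y)) ∂κ = 0) : H =ᵐ[κ] 0 := by
  -- Tilting by `t₀ + 1` rather than `t₀` makes the exponential moments of `u` exist for all `s <
  -- 1`, an open set around `0`.
  set u : ℝ → ℝ := fun y => H y * Real.exp (-((t₀ + 1) * y)) with hu
  have hum : Measurable u := by fun_prop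
  have huI : Integrable u κ := hint _ (by linarith)
  have hus : ∀ s y, u y * Real.exp (s * y) = H y * Real.exp (-((t₀ + 1 - s) * y)) := by
    intro s y
    rw [hu]; simp only; rw [mul_assoc, ← Real.exp_add]; congr 2; ring
  have hI : ∀ s < 1, Integrable (fun y => u y * Real.exp (s * y)) κ := by
    intro s hs
    simp_rw [hus]
    exact hint _ (by linarith)
  have h0 : ∀ s < 1, ∫ y, u y * Real.exp (s * y) ∂κ = 0 := by
    intro s hs
    simp_rw [hus]
    exact hzero _ (by linarith)
  -- The positive and negative parts of `u` define two finite measures. The vanishing integrals say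
  -- that their moment generating functions agree, and the aim is `P = N`.
  set P : Measure ℝ := κ.withDensity fun y => ENNReal.ofReal (u y) with hP
  set N : Measure ℝ := κ.withDensity fun y => ENNReal.ofReal (-u y) with hN
  have hPf : IsFiniteMeasure P := isFiniteMeasure_withDensity_ofReal huI.2
  have hNf : IsFiniteMeasure N := isFiniteMeasure_withDensity_ofReal huI.neg.2
  have hmax : ∀ s < 1, ∀ v : ℝ → ℝ, Measurable v → (∀ y, |v y| ≤ |u y|) →
      Integrable (fun y => v y * Real.exp (s * y)) κ := by
    intro s hs v hv hvu
    refine (hI s hs).mono (by fun_prop) (Eventually.of_forall fun y => ?_)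
    simp only [norm_mul, Real.norm_eq_abs]
    exact mul_le_mul_of_nonneg_right (hvu y) (abs_nonneg _)
  have hmP : ∀ s < 1, Integrable (fun y => max (u y) 0 * Real.exp (s * y)) κ := fun s hs =>
    hmax s hs _ (by fun_prop) fun y => by
      rcases le_total (u y) 0 with h | h <;> simp [h]
  have hmN : ∀ s < 1, Integrable (fun y => max (-u y) 0 * Real.exp (s * y)) κ := fun s hs =>
    hmax s hs _ (by fun_prop) fun y => by
      rcases le_total (u y) 0 with h | h <;> simp [h]
  have hPI : ∀ s < 1, s ∈ ProbabilityTheory.integrableExpSet id P := by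
    intro s hs
    refine (integrable_withDensity_iff_integrable_smul' (by fun_prop) (by simp)).2 ?_
    simpa [ENNReal.toReal_ofReal'] using hmP s hs
  have hNI : ∀ s < 1, s ∈ ProbabilityTheory.integrableExpSet id N := by
    intro s hs
    refine (integrable_withDensity_iff_integrable_smul' (by fun_prop) (by simp)).2 ?_
    simpa [ENNReal.toReal_ofReal'] using hmN s hs
  have hmgf : ∀ s < 1, ProbabilityTheory.mgf id P s = ProbabilityTheory.mgf id N s := by
    intro s hs
    unfold ProbabilityTheory.mgf
    rw [hP, hN, integral_withDensity_eq_integral_toReal_smul (by fun_prop) (by simp),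
      integral_withDensity_eq_integral_toReal_smul (by fun_prop) (by simp), ← sub_eq_zero]
    simp only [ENNReal.toReal_ofReal', smul_eq_mul, id]
    rw [← integral_sub (hmP s hs) (hmN s hs)]
    refine Eq.trans (integral_congr_ae (Eventually.of_forall fun y => ?_)) (h0 s hs)
    simp only [← sub_mul, max_zero_sub_max_neg_zero_eq_self]
  have hintP : ∀ s < 1, s ∈ interior (ProbabilityTheory.integrableExpSet id P) := fun s hs =>
    mem_interior.2 ⟨Iio 1, fun x hx => hPI x hx, isOpen_Iio, hs⟩
  have hintN : ∀ s < 1, s ∈ interior (ProbabilityTheory.integrableExpSet id N) := fun s hs =>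
    mem_interior.2 ⟨Iio 1, fun x hx => hNI x hx, isOpen_Iio, hs⟩
  have hEq : EqOn (ProbabilityTheory.complexMGF id P) (ProbabilityTheory.complexMGF id N)
      {z | z.re < 1} := by
    refine AnalyticOnNhd.eqOn_of_preconnected_of_frequently_eq (z₀ := 0)
      (ProbabilityTheory.analyticOnNhd_complexMGF.mono fun z hz => hintP _ hz)
      (ProbabilityTheory.analyticOnNhd_complexMGF.mono fun z hz => hintN _ hz)
      (convex_halfSpace_re_lt 1).isPreconnected (by simp) ?_
    -- Agreement on the real axis near `0` suffices for the identity theorem on the half-plane,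
    -- which contains the imaginary axis and so the characteristic functions.
    have h1 : ∀ᶠ s : ℝ in 𝓝[≠] 0, ProbabilityTheory.complexMGF id P (s : ℂ) =
        ProbabilityTheory.complexMGF id N (s : ℂ) := by
      filter_upwards [nhdsWithin_le_nhds (Iio_mem_nhds (show (0 : ℝ) < 1 by norm_num))] with s hs
      rw [ProbabilityTheory.complexMGF_ofReal, ProbabilityTheory.complexMGF_ofReal, hmgf s hs]
    have h2 : Tendsto (fun s : ℝ => (s : ℂ)) (𝓝[≠] 0) (𝓝[≠] 0) := by
      refine tendsto_nhdsWithin_iff.2 ⟨?_, ?_⟩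
      · exact (Complex.continuous_ofReal.tendsto' 0 0 (by simp)).mono_left nhdsWithin_le_nhds
      · filter_upwards [self_mem_nhdsWithin] with s hs
        simpa using hs
    exact h2.frequently h1.frequently
  have hPN : P = N := by
    refine Measure.ext_of_charFun (funext fun t => ?_)
    rw [← ProbabilityTheory.complexMGF_id_mul_I, ← ProbabilityTheory.complexMGF_id_mul_I]
    exact hEq (by simp)
  have := (withDensity_eq_iff (by fun_prop) (by fun_prop) (huI.lintegral_lt_top.ne)).1 hPN
  filter_upwards [this] with y hy
  have hy0 : u y = 0 := by
    have := congrArg ENNReal.toReal hy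
    simp only [ENNReal.toReal_ofReal'] at this
    rcases le_total (u y) 0 with h | h <;> simp [h] at this <;> linarith
  simpa [hu, Real.exp_ne_zero] using hy0

/-- Uniqueness of the Laplace transform, for functions of a real random variable `q`. -/
theorem ae_eq_zero_of_laplace {X : Type*} [MeasurableSpace X] {μ : Measure X} {q : X → ℝ}
    (hq : Measurable q) {H : ℝ → ℂ} (hH : Measurable H) {t₀ : ℝ}
    (hint : ∀ t, t₀ ≤ t → Integrable (fun x => H (q x) * (Real.exp (-(t * q x)) : ℝ)) μ)
    (hzero : ∀ t, t₀ ≤ t → ∫ x, H (q x) * (Real.exp (-(t * q x)) : ℝ) ∂μ = 0) :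
    ∀ᵐ x ∂μ, H (q x) = 0 := by
  have hI : ∀ t, t₀ ≤ t →
      Integrable (fun y => H y * (Real.exp (-(t * y)) : ℝ)) (μ.map q) := fun t ht =>
    (integrable_map_measure (by fun_prop) hq.aemeasurable).2 (hint t ht)
  have h0 : ∀ t, t₀ ≤ t → ∫ y, H y * (Real.exp (-(t * y)) : ℝ) ∂(μ.map q) = 0 := fun t ht => by
    rw [integral_map hq.aemeasurable (by fun_prop)]
    exact hzero t ht
  have hre : (fun y => (H y).re) =ᵐ[μ.map q] 0 := by
    refine ae_eq_zero_of_laplace_real (t₀ := t₀) (by fun_prop) (fun t ht => ?_) fun t ht => ?_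
    · simpa only [RCLike.re_eq_complex_re, Complex.re_mul_ofReal] using (hI t ht).re
    · have := integral_re (hI t ht)
      simpa only [RCLike.re_eq_complex_re, Complex.re_mul_ofReal, h0 t ht, Complex.zero_re]
        using this
  have him : (fun y => (H y).im) =ᵐ[μ.map q] 0 := by
    refine ae_eq_zero_of_laplace_real (t₀ := t₀) (by fun_prop) (fun t ht => ?_) fun t ht => ?_
    · simpa only [RCLike.im_eq_complex_im, Complex.im_mul_ofReal] using (hI t ht).im
    · have := integral_im (hI t ht)
      simpa only [RCLike.im_eq_complex_im, Complex.im_mul_ofReal, h0 t ht, Complex.zero_im]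
        using this
  refine ae_of_ae_map hq.aemeasurable (p := fun y => H y = 0) ?_
  filter_upwards [hre, him] with y h1 h2
  exact Complex.ext h1 h2

/-! ### Total families in Hilbert spaces and Gram matrices. -/

section TotalFamilies

open scoped InnerProductSpace

variable {ι H₁ H₂ : Type*} [NormedAddCommGroup H₁] [InnerProductSpace ℂ H₁] [CompleteSpace H₁]
  [NormedAddCommGroup H₂] [InnerProductSpace ℂ H₂] [CompleteSpace H₂]

lemma denseRange_linearCombination_of_total {e : ι → H₁}
    (he : ∀ x, (∀ i, ⟪e i, x⟫_ℂ = 0) → x = 0) :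
    DenseRange (Finsupp.linearCombination ℂ e) := by
  rw [DenseRange, ← LinearMap.coe_range, Finsupp.range_linearCombination,
    Submodule.dense_iff_topologicalClosure_eq_top, Submodule.topologicalClosure_eq_top_iff,
    Submodule.eq_bot_iff]
  exact fun x hx => he x fun i =>
    (Submodule.mem_orthogonal _ x).1 hx _ (Submodule.subset_span (mem_range_self i))

/-- Two total families with the same Gram matrix are related by a unitary operator. -/
theorem exists_linearIsometryEquiv_of_gram {e : ι → H₁} {e' : ι → H₂}
    (he : ∀ x, (∀ i, ⟪e i, x⟫_ℂ = 0) → x = 0) (he' : ∀ x, (∀ i, ⟪e' i, x⟫_ℂ = 0) → x = 0)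
    (hgram : ∀ i j, ⟪e' i, e' j⟫_ℂ = ⟪e i, e j⟫_ℂ) :
    ∃ U : H₁ ≃ₗᵢ[ℂ] H₂, ∀ i, U (e i) = e' i := by
  have hin : ∀ x y : ι →₀ ℂ, ⟪Finsupp.linearCombination ℂ e' x, Finsupp.linearCombination ℂ e' y⟫_ℂ
      = ⟪Finsupp.linearCombination ℂ e x, Finsupp.linearCombination ℂ e y⟫_ℂ := by
    intro x y
    simp only [Finsupp.linearCombination_apply, Finsupp.sum_inner, Finsupp.inner_sum,
      inner_smul_left, inner_smul_right, hgram]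
  have hnorm : ∀ x : ι →₀ ℂ, ‖Finsupp.linearCombination ℂ e' (LinearEquiv.refl ℂ _ x)‖
      = ‖Finsupp.linearCombination ℂ e x‖ := by
    intro x
    rw [@norm_eq_sqrt_re_inner ℂ, @norm_eq_sqrt_re_inner ℂ, LinearEquiv.refl_apply, hin]
  refine ⟨(LinearEquiv.refl ℂ (ι →₀ ℂ)).extendOfIsometry _ _
    (denseRange_linearCombination_of_total he) (denseRange_linearCombination_of_total he') hnorm,
    fun i => ?_⟩
  have := LinearEquiv.extendOfIsometry_eq (LinearEquiv.refl ℂ (ι →₀ ℂ)) _ _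
    (denseRange_linearCombination_of_total he) (denseRange_linearCombination_of_total he') hnorm
    (Finsupp.single i 1)
  simpa using this

end TotalFamilies

/-- Uniqueness for the transform with kernel `p^ν exp(-t p²/2)`. -/
lemma ae_eq_zero_of_integral_gaussian {X : Type*} [MeasurableSpace X] {μ : Measure X} {p : X → ℝ}
    (hp : Measurable p) (hp0 : ∀ᵐ x ∂μ, 0 < p x) {H : ℝ → ℂ} (hH : Measurable H) {ν t₀ : ℝ}
    (hint : ∀ t, t₀ ≤ t → Integrable (fun x => H (p x) * (gaussian ν t (p x) : ℝ)) μ)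
    (hzero : ∀ t, t₀ ≤ t → ∫ x, H (p x) * (gaussian ν t (p x) : ℝ) ∂μ = 0) :
    ∀ᵐ x ∂μ, H (p x) = 0 := by
  -- In the variable `y = p²/2` the Gaussian is the Laplace kernel; the power `p^ν` is absorbed into
  -- the unknown function.
  set G : ℝ → ℂ := fun y => H (√(2 * y)) * ((√(2 * y) ^ ν : ℝ) : ℂ) with hG
  have hGm : Measurable G := by fun_prop
  have hs : ∀ {y : ℝ}, 0 < y → √(2 * (y ^ 2 / 2)) = y := fun hy => by
    rw [mul_div_cancel₀ _ two_ne_zero, Real.sqrt_sq hy.le]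
  have hcongr : ∀ t, (fun x => G (p x ^ 2 / 2) * (Real.exp (-(t * (p x ^ 2 / 2))) : ℝ)) =ᵐ[μ]
      fun x => H (p x) * (gaussian ν t (p x) : ℝ) := by
    intro t
    filter_upwards [hp0] with x hx
    simp only [hG, hs hx, gaussian]
    push_cast
    rw [mul_assoc, mul_div_assoc]
  have := ae_eq_zero_of_laplace (μ := μ) (q := fun x => p x ^ 2 / 2) (by fun_prop) hGm
    (fun t ht => (hint t ht).congr (hcongr t).symm)
    fun t ht => (integral_congr_ae (hcongr t)).trans (hzero t ht)
  filter_upwards [this, hp0] with x hx hx0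
  simp only [hG, hs hx0, mul_eq_zero, Complex.ofReal_eq_zero] at hx
  exact hx.resolve_right (Real.rpow_pos_of_pos hx0 ν).ne'

/-! ### Integration against `r^(n-1) dr`. -/

section RadialMeasure

variable {n : ℕ}

lemma ae_radialMeasure_pos : ∀ᵐ r ∂(radialMeasure n), 0 < r :=
  (withDensity_absolutelyContinuous _ _).ae_le (ae_restrict_mem measurableSet_Ioi)

lemma integrable_radialMeasure_iff {E : Type*} [NormedAddCommGroup E] [NormedSpace ℝ E]
    {f : ℝ → E} :
    Integrable f (radialMeasure n) ↔ IntegrableOn (fun r => r ^ (n - 1) • f r) (Ioi 0) := by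
  unfold radialMeasure
  rw [integrable_withDensity_iff_integrable_smul' (by fun_prop) (by simp)]
  refine integrable_congr ?_
  filter_upwards [ae_restrict_mem measurableSet_Ioi] with r hr
  rw [ENNReal.toReal_ofReal (pow_nonneg (le_of_lt hr) _)]

lemma integral_radialMeasure {E : Type*} [NormedAddCommGroup E] [NormedSpace ℝ E] (f : ℝ → E) :
    ∫ r, f r ∂(radialMeasure n) = ∫ r in Ioi (0 : ℝ), r ^ (n - 1) • f r := by
  unfold radialMeasure
  rw [integral_withDensity_eq_integral_toReal_smul (by fun_prop) (by simp)]
  refine setIntegral_congr_fun measurableSet_Ioi fun r hr => ?_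
  rw [ENNReal.toReal_ofReal (pow_nonneg (le_of_lt hr) _)]

instance : SigmaFinite (radialMeasure n) :=
  SigmaFinite.withDensity_of_ne_top' fun _ => ENNReal.ofReal_ne_top

lemma pow_mul_gaussian {q t r : ℝ} (hn : 1 ≤ n) (hr : 0 < r) :
    r ^ (n - 1) * gaussian q t r = gaussian (q + n - 1) t r := by
  have : r ^ (n - 1) = r ^ ((n : ℝ) - 1) := by
    rw [← Real.rpow_natCast, Nat.cast_sub hn, Nat.cast_one]
  rw [this, rpow_mul_gaussian hr]
  congr 1; ring

lemma integrable_gaussian_radialMeasure {q a : ℝ} (hn : 1 ≤ n) (hq : -1 < q + n - 1)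
    (ha : 0 < a) : Integrable (gaussian q a) (radialMeasure n) :=
  integrable_radialMeasure_iff.2 <| (integrableOn_gaussian hq ha).congr_fun
    (fun _ hr => (pow_mul_gaussian hn hr).symm) measurableSet_Ioi

lemma integral_gaussian_radialMeasure {q ν a : ℝ} (hn : 1 ≤ n) (hν : -1 < ν) (ha : 0 < a)
    (hq : q + n = 2 * ν + 2) : ∫ r, gaussian q a r ∂(radialMeasure n) = gaussMoment ν a := by
  rw [integral_radialMeasure, ← integral_gaussian hν ha]
  refine setIntegral_congr_fun measurableSet_Ioi fun r hr => ?_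
  simp only [smul_eq_mul]
  rw [pow_mul_gaussian hn hr, show q + n - 1 = 2 * ν + 1 by linarith]

end RadialMeasure

/-! ### The energy measure and the change of variables to momentum. -/

section EnergyMeasure

variable {m : ℝ}

lemma measurable_momentum : Measurable (momentum m) := by
  unfold momentum; fun_prop

lemma momentum_neg (E : ℝ) : momentum m (-E) = momentum m E := by
  simp [momentum]

lemma momentum_nonneg (E : ℝ) : 0 ≤ momentum m E := Real.sqrt_nonneg _

lemma momentum_pos (hm : 0 < m) {E : ℝ} (hE : m < |E|) : 0 < momentum m E := by
  refine Real.sqrt_pos.2 (sub_pos.2 ?_)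
  rw [← sq_abs E]
  gcongr

lemma momentum_sq (hm : 0 < m) {E : ℝ} (hE : m < |E|) : momentum m E ^ 2 = E ^ 2 - m ^ 2 :=
  Real.sq_sqrt (Real.sqrt_pos.1 (momentum_pos hm hE)).le

lemma ae_energyMeasure_lt_abs : ∀ᵐ E ∂(energyMeasure m), m < |E| := by
  filter_upwards [(withDensity_absolutelyContinuous _ _).ae_le
    (ae_restrict_mem measurableSet_Icc.compl)] with E hE
  rwa [mem_compl_iff, mem_Icc, ← abs_le, not_le] at hE

instance : SigmaFinite (energyMeasure m) :=
  SigmaFinite.withDensity_of_ne_top' fun _ => ENNReal.ofReal_ne_top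

lemma lintegral_energyMeasure {f : ℝ → ℝ≥0∞} (hf : Measurable f) :
    ∫⁻ E, f E ∂(energyMeasure m) = ∫⁻ E in (Icc (-m) m)ᶜ, ENNReal.ofReal |E| * f E := by
  unfold energyMeasure
  rw [lintegral_withDensity_eq_lintegral_mul _ (by fun_prop) hf]
  rfl

lemma measurePreserving_neg_energyMeasure :
    MeasurePreserving (fun E : ℝ => -E) (energyMeasure m) (energyMeasure m) := by
  refine ⟨measurable_neg, Measure.ext_of_lintegral _ fun f hf => ?_⟩
  rw [lintegral_map hf measurable_neg, lintegral_energyMeasure (f := fun E => f (-E)) (hf.comp measurable_neg),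
    lintegral_energyMeasure hf, ← lintegral_indicator measurableSet_Icc.compl,
    ← lintegral_indicator measurableSet_Icc.compl, ← lintegral_neg_eq_self]
  congr 1; ext E
  have : -E ∈ (Icc (-m) m)ᶜ ↔ E ∈ (Icc (-m) m)ᶜ := by
    simp only [mem_compl_iff, mem_Icc, ← abs_le, abs_neg]
  by_cases h : E ∈ (Icc (-m) m)ᶜ
  · rw [indicator_of_mem h, indicator_of_mem (this.2 h)]; simp
  · rw [indicator_of_notMem h, indicator_of_notMem (this.not.2 h)]

/-- From `p² = E² - m²` one gets `E dE = p dp`. -/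
lemma lintegral_Ioi_momentum (hm : 0 < m) (f : ℝ → ℝ≥0∞) :
    ∫⁻ E in Ioi m, ENNReal.ofReal |E| * f (momentum m E) =
      ∫⁻ p in Ioi 0, ENNReal.ofReal p * f p := by
  have himg : momentum m '' Ioi m = Ioi 0 := by
    ext p
    constructor
    · rintro ⟨E, hE, rfl⟩
      exact momentum_pos hm (lt_of_lt_of_le hE (le_abs_self E))
    · intro hp
      refine ⟨√(p ^ 2 + m ^ 2), Real.lt_sqrt_of_sq_lt (by nlinarith [show 0 < p from hp]), ?_⟩
      rw [momentum, Real.sq_sqrt (by positivity), add_sub_cancel_right, Real.sqrt_sq (le_of_lt hp)]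
  have hlt : ∀ {E : ℝ}, E ∈ Ioi m → m < |E| := fun hE => lt_of_lt_of_le hE (le_abs_self _)
  have hinj : InjOn (momentum m) (Ioi m) := by
    intro E hE E' hE' h
    have h2 := congrArg (· ^ 2) h
    simp only [momentum_sq hm (hlt hE), momentum_sq hm (hlt hE')] at h2
    have hE : m < E := hE
    have hE' : m < E' := hE'
    nlinarith
  have hder : ∀ E ∈ Ioi m, HasDerivWithinAt (momentum m) (E / momentum m E) (Ioi m) E := by
    intro E hE
    have h1 : HasDerivAt (fun E : ℝ => E ^ 2 - m ^ 2) (2 * E) E := by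
      simpa using (hasDerivAt_pow 2 E).sub_const (m ^ 2)
    have h2 := h1.sqrt (Real.sqrt_pos.1 (momentum_pos hm (hlt hE))).ne'
    refine (h2.congr_deriv ?_).hasDerivWithinAt
    rw [momentum, mul_div_mul_left _ _ two_ne_zero]
  rw [← himg, lintegral_image_eq_lintegral_abs_deriv_mul measurableSet_Ioi hder hinj]
  refine setLIntegral_congr_fun measurableSet_Ioi fun E hE => ?_
  have hp := momentum_pos hm (hlt hE)
  rw [← mul_assoc, ← ENNReal.ofReal_mul (abs_nonneg _), abs_div, abs_of_pos hp,
    div_mul_cancel₀ _ hp.ne']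

/-- The factor `2` counts the branches `E > m` and `E < -m`; `radialMeasure 2` serves as the measure
`p dp` whatever the dimension `n` of the problem. -/
lemma map_momentum_energyMeasure (hm : 0 < m) :
    (energyMeasure m).map (momentum m) = (2 : ℝ≥0∞) • radialMeasure 2 := by
  refine Measure.ext_of_lintegral _ fun f hf => ?_
  rw [lintegral_map hf measurable_momentum, lintegral_smul_measure,
    lintegral_energyMeasure (f := fun E => f (momentum m E)) (hf.comp measurable_momentum), radialMeasure,
    lintegral_withDensity_eq_lintegral_mul _ (by fun_prop) hf]
  have hset : (Icc (-m) m)ᶜ = Iio (-m) ∪ Ioi m := by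
    ext E; simp only [mem_compl_iff, mem_Icc, mem_union, mem_Iio, mem_Ioi]
    rw [not_and_or, not_le, not_le]
  have hdisj : Disjoint (Iio (-m)) (Ioi m) := by
    refine Set.disjoint_left.2 fun E h1 h2 => ?_
    simp only [mem_Iio, mem_Ioi] at h1 h2
    linarith
  have hneg : ∫⁻ E in Iio (-m), ENNReal.ofReal |E| * f (momentum m E) =
      ∫⁻ E in Ioi m, ENNReal.ofReal |E| * f (momentum m E) := by
    rw [← lintegral_indicator measurableSet_Iio, ← lintegral_indicator measurableSet_Ioi,
      ← lintegral_neg_eq_self]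
    congr 1; ext E
    by_cases h : m < E
    · rw [indicator_of_mem (show E ∈ Ioi m from h), indicator_of_mem (by simpa using h), abs_neg,
        momentum_neg]
    · rw [indicator_of_notMem (show E ∉ Ioi m from h), indicator_of_notMem (by simpa using h)]
  rw [hset, lintegral_union measurableSet_Ioi hdisj]
  rw [hneg, lintegral_Ioi_momentum hm, ← two_mul]
  simp

lemma integrable_comp_momentum {F : Type*} [NormedAddCommGroup F] (hm : 0 < m)
    {g : ℝ → F} (hg : Integrable g (radialMeasure 2)) :
    Integrable (fun E => g (momentum m E)) (energyMeasure m) := by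
  have h : Integrable g ((energyMeasure m).map (momentum m)) := by
    rw [map_momentum_energyMeasure hm]
    exact hg.smul_measure (by simp)
  exact h.comp_measurable measurable_momentum

lemma integral_comp_momentum {F : Type*} [NormedAddCommGroup F] [NormedSpace ℝ F] (hm : 0 < m)
    {g : ℝ → F} (hg : AEStronglyMeasurable g (radialMeasure 2)) :
    ∫ E, g (momentum m E) ∂(energyMeasure m) = (2 : ℝ) • ∫ p, g p ∂(radialMeasure 2) := by
  have h : AEStronglyMeasurable g ((energyMeasure m).map (momentum m)) := by
    rw [map_momentum_energyMeasure hm]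
    exact hg.smul_measure _
  rw [← integral_map measurable_momentum.aemeasurable h, map_momentum_energyMeasure hm,
    integral_smul_measure]
  simp

/-- Folding the energy integral: the two energies `±E` have the same momentum. -/
lemma integral_energyMeasure_of_fold (hm : 0 < m) {h g : ℝ → ℂ}
    (hh : Integrable h (energyMeasure m)) (hg : AEStronglyMeasurable g (radialMeasure 2))
    (hfold : ∀ E, m < |E| → h E + h (-E) = g (momentum m E)) :
    ∫ E, h E ∂(energyMeasure m) = ∫ p, g p ∂(radialMeasure 2) := by
  have hmp := measurePreserving_neg_energyMeasure (m := m)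
  have hemb : MeasurableEmbedding (fun E : ℝ => -E) := (MeasurableEquiv.neg ℝ).measurableEmbedding
  have h1 : ∫ E, h (-E) ∂(energyMeasure m) = ∫ E, h E ∂(energyMeasure m) :=
    hmp.integral_comp hemb h
  have h2 : Integrable (fun E => h (-E)) (energyMeasure m) := (hmp.integrable_comp_emb hemb).2 hh
  -- Both sides carry a factor `2`: the left because the measure is even, the right because there
  -- are two branches.
  have h3 : ∫ E, (h E + h (-E)) ∂(energyMeasure m) = (2 : ℝ) • ∫ p, g p ∂(radialMeasure 2) := by
    rw [← integral_comp_momentum hm hg]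
    refine integral_congr_ae ?_
    filter_upwards [ae_energyMeasure_lt_abs] with E hE using hfold E hE
  rw [integral_add hh h2, h1, ← two_smul ℝ] at h3
  exact (smul_right_injective ℂ (two_ne_zero (α := ℝ))) h3

end EnergyMeasure

/-! ### Algebra of the amplitudes at the energies `±E`. -/

section Amplitude

/-- The amplitudes `N⁺(E)` and `-i s sgn(E) N⁻(E)` of the two components of `ψ_k`. -/
def amplitude (s m E : ℝ) : Fin 2 → ℂ :=
  ![(normPlus m E : ℂ), -Complex.I * ((s * Real.sign E * normMinus m E : ℝ) : ℂ)]

variable {s m : ℝ}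

lemma normPlus_neg (E : ℝ) : normPlus m (-E) = normMinus m E := by
  unfold normPlus normMinus
  rw [← neg_div_neg_eq]; congr 2 <;> ring

lemma normMinus_neg (E : ℝ) : normMinus m (-E) = normPlus m E := by
  rw [← normPlus_neg, neg_neg]

lemma normPlus_sq (hm : 0 < m) {E : ℝ} (hE : m < |E|) : normPlus m E ^ 2 = (E + m) / (2 * E) := by
  refine Real.sq_sqrt ?_
  rcases lt_abs.1 hE with h | h
  · have : 0 < E := hm.trans h
    positivity
  · exact div_nonneg_of_nonpos (by linarith) (by linarith)

lemma normMinus_sq (hm : 0 < m) {E : ℝ} (hE : m < |E|) :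
    normMinus m E ^ 2 = (E - m) / (2 * E) := by
  rw [← normPlus_neg, normPlus_sq hm (by rwa [abs_neg]), ← neg_div_neg_eq]; congr 1 <;> ring

lemma abs_mul_normPlus_mul_normMinus (hm : 0 < m) {E : ℝ} (hE : m < |E|) :
    |E| * (normPlus m E * normMinus m E) = momentum m E / 2 := by
  have hE0 : E ≠ 0 := fun h => by simp [h] at hE; linarith
  have hN : 0 ≤ normPlus m E * normMinus m E := mul_nonneg (Real.sqrt_nonneg _) (Real.sqrt_nonneg _)
  rw [← sq_eq_sq₀ (mul_nonneg (abs_nonneg _) hN) (div_nonneg (momentum_nonneg E) two_pos.le), mul_pow, mul_pow, sq_abs,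
    normPlus_sq hm hE, normMinus_sq hm hE, div_pow, momentum_sq hm hE]
  field_simp; ring

lemma measurable_amplitude (b : Fin 2) : Measurable fun E => amplitude s m E b := by
  have hs : Measurable Real.sign := by
    unfold Real.sign
    exact Measurable.ite measurableSet_Iio measurable_const
      (Measurable.ite measurableSet_Ioi measurable_const measurable_const)
  fin_cases b
  · simp only [amplitude, normPlus]; simp; fun_prop
  · simp only [amplitude, normMinus]; simp; fun_prop

lemma measurable_star_amplitude (b : Fin 2) : Measurable fun E => star (amplitude s m E b) :=
  continuous_star.measurable.comp (measurable_amplitude b)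

lemma sign_sq {E : ℝ} (hE : E ≠ 0) : Real.sign E ^ 2 = 1 := by
  rcases hE.lt_or_gt with h | h
  · simp [Real.sign_of_neg h]
  · simp [Real.sign_of_pos h]

lemma star_amplitude_mul (b c : Fin 2) (E : ℝ) :
    star (amplitude s m E b) * amplitude s m E c =
      !![((normPlus m E ^ 2 : ℝ) : ℂ),
          -Complex.I * ((s * Real.sign E * (normPlus m E * normMinus m E) : ℝ) : ℂ);
        Complex.I * ((s * Real.sign E * (normPlus m E * normMinus m E) : ℝ) : ℂ),
        ((s ^ 2 * Real.sign E ^ 2 * normMinus m E ^ 2 : ℝ) : ℂ)] b c := by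
  fin_cases b <;> fin_cases c <;> simp [amplitude] <;> ring_nf
  simp

lemma ne_zero_of_lt_abs (hm : 0 < m) {E : ℝ} (hE : m < |E|) : E ≠ 0 := fun h => by
  simp [h] at hE; linarith

lemma norm_amplitude_le (hm : 0 < m) (hs : s ^ 2 = 1) {E : ℝ} (hE : m < |E|) (b : Fin 2) :
    ‖amplitude s m E b‖ ≤ 1 := by
  have h := star_amplitude_mul (s := s) (m := m) b b E
  have h0 := ne_zero_of_lt_abs hm hE
  have hmE : |m / E| ≤ 1 := by
    rw [abs_div, abs_of_pos hm]; exact div_le_one_of_le₀ hE.le (abs_nonneg _)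
  have hsq : ‖amplitude s m E b‖ ^ 2 ≤ 1 := by
    have h2 : ‖amplitude s m E b‖ ^ 2 = ‖star (amplitude s m E b) * amplitude s m E b‖ := by
      rw [norm_mul, norm_star, sq]
    rw [h2, h]
    fin_cases b
    · simp only [Fin.zero_eta, Matrix.of_apply, Matrix.cons_val', Matrix.cons_val_zero,
        Complex.norm_real]
      rw [normPlus_sq hm hE, show (E + m) / (2 * E) = 1 / 2 + m / E / 2 by field_simp,
        Real.norm_eq_abs, abs_le]
      rw [abs_le] at hmE
      constructor <;> linarith
    · simp only [Fin.mk_one, Matrix.of_apply, Matrix.cons_val', Matrix.cons_val_one,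
        Matrix.cons_val_fin_one, Complex.norm_real]
      rw [hs, sign_sq h0, normMinus_sq hm hE, one_mul, one_mul,
        show (E - m) / (2 * E) = 1 / 2 - m / E / 2 by field_simp, Real.norm_eq_abs, abs_le]
      rw [abs_le] at hmE
      constructor <;> linarith
  exact (sq_le_one_iff₀ (norm_nonneg _)).1 hsq

/-- Orthonormality of the amplitudes with respect to the pair of energies `±E`. -/
lemma star_amplitude_mul_add_neg (hm : 0 < m) (hs : s ^ 2 = 1) {E : ℝ} (hE : m < |E|)
    (b c : Fin 2) :
    star (amplitude s m E b) * amplitude s m E c +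
      star (amplitude s m (-E) b) * amplitude s m (-E) c = if b = c then 1 else 0 := by
  have h0 := ne_zero_of_lt_abs hm hE
  rw [star_amplitude_mul, star_amplitude_mul, normPlus_neg, normMinus_neg, Real.sign_neg, hs,
    neg_sq, sign_sq h0, normPlus_sq hm hE, normMinus_sq hm hE]
  have hsum : (E + m) / (2 * E) + (E - m) / (2 * E) = 1 := by field_simp; ring
  have hC := congrArg Complex.ofReal hsum
  push_cast at hC
  fin_cases b <;> fin_cases c
  · simp; linear_combination hC
  · simp; ring
  · simp; ring
  · simp; linear_combination hC

/-- The amplitudes at `E` and `-E` form a unitary `2 × 2` matrix. This is orthonormality in the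
other index, and it recovers a function of `E` from its two folded components. -/
lemma sum_amplitude_mul_star (hm : 0 < m) (hs : s ^ 2 = 1) {E : ℝ} (hE : m < |E|) :
    ∑ b, amplitude s m E b * star (amplitude s m E b) = 1 ∧
      ∑ b, amplitude s m E b * star (amplitude s m (-E) b) = 0 := by
  have h0 := ne_zero_of_lt_abs hm hE
  constructor
  · simp_rw [mul_comm (amplitude s m E _), star_amplitude_mul]
    rw [Fin.sum_univ_two, hs, sign_sq h0, normPlus_sq hm hE, normMinus_sq hm hE]
    have hsum : (E + m) / (2 * E) + (E - m) / (2 * E) = 1 := by field_simp; ring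
    have hC := congrArg Complex.ofReal hsum
    push_cast at hC
    simp; linear_combination hC
  · rw [Fin.sum_univ_two]
    simp only [amplitude, normPlus_neg, normMinus_neg, Real.sign_neg]
    have h2 : ((s * Real.sign E : ℝ) : ℂ) ^ 2 = 1 := by
      rw [← Complex.ofReal_pow, mul_pow, hs, sign_sq h0]; simp
    simp
    push_cast at h2
    linear_combination (-(normPlus m E : ℂ) * normMinus m E) * h2 + (normPlus m E : ℂ) * normMinus m E * (s * Real.sign E)^2 * (Complex.I_sq)

end Amplitude

/-! ### Energy integrals by folding, and totality of the Gaussians. -/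

section EnergyIntegrals

variable {s m : ℝ}

lemma integrable_amplitude_mul (hm : 0 < m) (hs : s ^ 2 = 1) (b : Fin 2) {f : ℝ → ℂ}
    (hf : Integrable f (energyMeasure m)) :
    Integrable (fun E => amplitude s m E b * f E) (energyMeasure m) := by
  refine hf.bdd_mul (c := 1) (measurable_amplitude b).aestronglyMeasurable ?_
  filter_upwards [ae_energyMeasure_lt_abs] with E hE using norm_amplitude_le hm hs hE b

lemma integrable_star_amplitude_mul (hm : 0 < m) (hs : s ^ 2 = 1) (b : Fin 2) {f : ℝ → ℂ}
    (hf : Integrable f (energyMeasure m)) :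
    Integrable (fun E => star (amplitude s m E b) * f E) (energyMeasure m) := by
  refine hf.bdd_mul (c := 1) (measurable_star_amplitude b).aestronglyMeasurable ?_
  filter_upwards [ae_energyMeasure_lt_abs] with E hE
  rw [norm_star]
  exact norm_amplitude_le hm hs hE b

/-- Adding the contributions of `E` and `-E` separates the components, leaving a scalar integral in
`p`. -/
lemma integral_star_amplitude_mul (hm : 0 < m) (hs : s ^ 2 = 1) (b c : Fin 2) {g : ℝ → ℂ}
    (hg : Integrable g (radialMeasure 2)) :
    ∫ E, star (amplitude s m E b) * (amplitude s m E c * g (momentum m E)) ∂(energyMeasure m) =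
      if b = c then ∫ p, g p ∂(radialMeasure 2) else 0 := by
  rw [integral_energyMeasure_of_fold hm (g := fun p => (if b = c then 1 else 0) * g p)
    (integrable_star_amplitude_mul hm hs _ (integrable_amplitude_mul hm hs _
      (integrable_comp_momentum hm hg))) (hg.1.const_mul _) fun E hE => ?_]
  · split_ifs <;> simp
  · rw [← star_amplitude_mul_add_neg hm hs hE, momentum_neg]
    ring

set_option maxHeartbeats 1000000 in
/-- Totality of the energy Gaussians. -/
theorem ae_eq_zero_of_integral_star_amplitude (hm : 0 < m) (hs : s ^ 2 = 1) {φ : ℝ → ℂ}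
    (hφ : Measurable φ) {ν : Fin 2 → ℝ} {t₀ : ℝ}
    (hint : ∀ b t, t₀ ≤ t → Integrable
      (fun E => star (amplitude s m E b) * ((gaussian (ν b) t (momentum m E) : ℝ) * φ E))
      (energyMeasure m))
    (hzero : ∀ b t, t₀ ≤ t →
      ∫ E, star (amplitude s m E b) * ((gaussian (ν b) t (momentum m E) : ℝ) * φ E)
        ∂(energyMeasure m) = 0) :
    φ =ᵐ[energyMeasure m] 0 := by
  have hmp := measurePreserving_neg_energyMeasure (m := m)
  have hemb : MeasurableEmbedding (fun E : ℝ => -E) := (MeasurableEquiv.neg ℝ).measurableEmbedding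
  -- The integral sees only the part of the integrand that is even in `E`. That part is a function
  -- of `|E| = √(p² + m²)`, hence of `p`, so the scalar uniqueness result applies.
  set h : Fin 2 → ℝ → ℂ := fun b E =>
    star (amplitude s m E b) * φ E + star (amplitude s m (-E) b) * φ (-E) with hh
  have hhm : ∀ b, Measurable (h b) := fun b => by
    have h1 := measurable_star_amplitude (s := s) (m := m) b
    have h2 := h1.comp measurable_neg
    exact (h1.mul hφ).add (h2.mul (hφ.comp measurable_neg))
  have habs : ∀ b E, h b |E| = h b E := by
    intro b E
    rcases abs_choice E with hE | hE <;> rw [hE]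
    simp only [hh, neg_neg]; ring
  have hsq : ∀ {E : ℝ}, m < |E| → √(momentum m E ^ 2 + m ^ 2) = |E| := fun hE => by
    rw [momentum_sq hm hE, sub_add_cancel, Real.sqrt_sq_eq_abs]
  have hcongr : ∀ b t, (fun E => h b (√(momentum m E ^ 2 + m ^ 2)) *
      (gaussian (ν b) t (momentum m E) : ℝ)) =ᵐ[energyMeasure m] fun E =>
      star (amplitude s m E b) * ((gaussian (ν b) t (momentum m E) : ℝ) * φ E) +
      star (amplitude s m (-E) b) * ((gaussian (ν b) t (momentum m (-E)) : ℝ) * φ (-E)) := by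
    intro b t
    filter_upwards [ae_energyMeasure_lt_abs] with E hE
    rw [hsq hE, habs, momentum_neg]
    simp only [hh]; ring
  have hneg : ∀ b t, t₀ ≤ t → Integrable (fun E => star (amplitude s m (-E) b) *
      ((gaussian (ν b) t (momentum m (-E)) : ℝ) * φ (-E))) (energyMeasure m) := fun b t ht =>
    (hmp.integrable_comp_emb hemb).2 (hint b t ht)
  have hb : ∀ b, ∀ᵐ E ∂(energyMeasure m), h b E = 0 := by
    intro b
    have := ae_eq_zero_of_integral_gaussian (μ := energyMeasure m) (p := momentum m)
      (H := fun y => h b (√(y ^ 2 + m ^ 2))) (ν := ν b) (t₀ := t₀) measurable_momentum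
      (by filter_upwards [ae_energyMeasure_lt_abs] with E hE using momentum_pos hm hE)
      ((hhm b).comp (by fun_prop)) (fun t ht => ((hint b t ht).add (hneg b t ht)).congr
        (hcongr b t).symm) fun t ht => ?_
    · filter_upwards [this, ae_energyMeasure_lt_abs] with E hE hE2
      rwa [hsq hE2, habs] at hE
    · rw [integral_congr_ae (hcongr b t), integral_add (hint b t ht) (hneg b t ht),
        hmp.integral_comp hemb (fun E => star (amplitude s m E b) *
          ((gaussian (ν b) t (momentum m E) : ℝ) * φ E)), hzero b t ht, add_zero]
  filter_upwards [ae_all_iff.2 hb, ae_energyMeasure_lt_abs] with E hE hE2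
  obtain ⟨h1, h2⟩ := sum_amplitude_mul_star hm hs hE2
  have : ∑ b, amplitude s m E b * h b E = φ E := by
    simp only [hh, mul_add, ← mul_assoc, Finset.sum_add_distrib, ← Finset.sum_mul, h1, h2]
    ring
  rw [← this]
  simp [hE]

/-- Totality of the radial Gaussians. -/
theorem ae_eq_zero_of_integral_radial_gaussian {n : ℕ} {h : ℝ → ℂ} (hh : Measurable h) {q t₀ : ℝ}
    (hint : ∀ t, t₀ ≤ t → Integrable (fun r => (gaussian q t r : ℝ) * h r) (radialMeasure n))
    (hzero : ∀ t, t₀ ≤ t → ∫ r, (gaussian q t r : ℝ) * h r ∂(radialMeasure n) = 0) :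
    h =ᵐ[radialMeasure n] 0 :=
  ae_eq_zero_of_integral_gaussian measurable_id ae_radialMeasure_pos hh
    (fun t ht => by simpa only [mul_comm, id] using hint t ht)
    fun t ht => by simpa only [mul_comm, id] using hzero t ht

end EnergyIntegrals

/-! ### The two Gaussian families and the unitary operator matching them. -/

section Families

variable {n : ℕ} {ν : Fin 2 → ℝ} {s m : ℝ}

/-- The exponent of `r^(-(n-2)/2) r^ν`. -/
def radialExp (n : ℕ) (ν : ℝ) : ℝ := (2 - (n : ℝ)) / 2 + ν

lemma memLp_two_of_gaussian_sq {q t : ℝ} (hn : 1 ≤ n) (hq : -1 < 2 * q + n - 1) (ht : 0 < t) :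
    MemLp (fun r => (gaussian q t r : ℂ)) 2 (radialMeasure n) := by
  have hm : Measurable fun r => (gaussian q t r : ℂ) :=
    Complex.measurable_ofReal.comp (measurable_gaussian _ _)
  refine (memLp_two_iff_integrable_sq_norm hm.aestronglyMeasurable).2 ?_
  refine (integrable_gaussian_radialMeasure (q := 2 * q) (a := 2 * t) hn hq (by positivity)).congr ?_
  filter_upwards [ae_radialMeasure_pos] with r hr
  rw [Complex.norm_real, Real.norm_eq_abs, sq_abs, sq, gaussian_mul_gaussian hr, two_mul, two_mul]

lemma memLp_single {f : ℝ → ℂ} {μ : Measure ℝ} (hf : MemLp f 2 μ) (b : Fin 2) :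
    MemLp (fun r => EuclideanSpace.single b (f r)) 2 μ := by
  have hc : Continuous fun z : ℂ => EuclideanSpace.single b z :=
    (Isometry.of_dist_eq fun z w => PiLp.dist_single_same 2 (fun _ => ℂ) b z w).continuous
  refine hf.mono (hc.comp_aestronglyMeasurable hf.1) (Eventually.of_forall fun r => ?_)
  simp

lemma memLp_radialGaussian (hn : 1 ≤ n) (hν : ∀ b, 0 ≤ ν b) (b : Fin 2) {t : ℝ} (ht : 0 < t) :
    MemLp (fun r => EuclideanSpace.single b (gaussian (radialExp n (ν b)) t r : ℂ)) 2
      (radialMeasure n) :=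
  memLp_single (memLp_two_of_gaussian_sq hn (by unfold radialExp; linarith [hν b]) ht) b

/-- The spinor `r^(-(n-2)/2) r^ν exp(-t r²/2)` in the component `b`. -/
def radialGaussian (hn : 1 ≤ n) (hν : ∀ b, 0 ≤ ν b) (b : Fin 2) {t : ℝ} (ht : 0 < t) :
    RadialL2 n := (memLp_radialGaussian hn hν b ht).toLp _

lemma integrable_gaussian_mul_apply (hn : 1 ≤ n) (hν : ∀ b, 0 ≤ ν b) (b : Fin 2) {t : ℝ}
    (ht : 0 < t) (f : RadialL2 n) :
    Integrable (fun r => (gaussian (radialExp n (ν b)) t r : ℂ) * f r b) (radialMeasure n) := by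
  refine (L2.integrable_inner (𝕜 := ℂ) (radialGaussian hn hν b ht) f).congr ?_
  filter_upwards [(memLp_radialGaussian hn hν b ht).coeFn_toLp] with r hr
  rw [radialGaussian, hr, EuclideanSpace.inner_single_left, Complex.conj_ofReal]

lemma inner_radialGaussian (hn : 1 ≤ n) (hν : ∀ b, 0 ≤ ν b) (b : Fin 2) {t : ℝ}
    (ht : 0 < t) (f : RadialL2 n) :
    inner ℂ (radialGaussian hn hν b ht) f =
      ∫ r, (gaussian (radialExp n (ν b)) t r : ℂ) * f r b ∂(radialMeasure n) := by
  rw [L2.inner_def]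
  refine integral_congr_ae ?_
  filter_upwards [(memLp_radialGaussian hn hν b ht).coeFn_toLp] with r hr
  rw [radialGaussian, hr, EuclideanSpace.inner_single_left, Complex.conj_ofReal]

lemma memLp_energyGaussian (hm : 0 < m) (hs : s ^ 2 = 1) (b : Fin 2) {a t : ℝ} (ha : -1 < a)
    (ht : 0 < t) :
    MemLp (fun E => amplitude s m E b * (gaussian a t (momentum m E) : ℂ)) 2
      (energyMeasure m) := by
  have hg : MemLp (fun E => (gaussian a t (momentum m E) : ℂ)) 2 (energyMeasure m) := by
    have hme : Measurable fun E => (gaussian a t (momentum m E) : ℂ) :=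
      Complex.measurable_ofReal.comp ((measurable_gaussian _ _).comp measurable_momentum)
    refine (memLp_two_iff_integrable_sq_norm hme.aestronglyMeasurable).2 ?_
    have hL := memLp_two_of_gaussian_sq (n := 2) (q := a) (by norm_num)
      (by push_cast; linarith) ht
    exact integrable_comp_momentum hm (g := fun p => ‖(gaussian a t p : ℂ)‖ ^ 2)
      ((memLp_two_iff_integrable_sq_norm hL.1).1 hL)
  refine hg.mono ((measurable_amplitude b).aestronglyMeasurable.mul hg.1) ?_
  filter_upwards [ae_energyMeasure_lt_abs] with E hE
  rw [norm_mul]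
  exact mul_le_of_le_one_left (norm_nonneg _) (norm_amplitude_le hm hs hE b)

lemma memLp_energyGaussian_const (hm : 0 < m) (hs : s ^ 2 = 1) (hν : ∀ b, 0 ≤ ν b) (b : Fin 2)
    {t : ℝ} (ht : 0 < t) :
    MemLp (fun E => ((t ^ (-ν b - 1) : ℝ) : ℂ) *
      (amplitude s m E b * (gaussian (ν b) t⁻¹ (momentum m E) : ℂ))) 2 (energyMeasure m) :=
  (memLp_energyGaussian hm hs b (by linarith [hν b]) (inv_pos.2 ht)).const_mul _

/-- The transform of `radialGaussian`. -/
def energyGaussian (hm : 0 < m) (hs : s ^ 2 = 1) (hν : ∀ b, 0 ≤ ν b) (b : Fin 2) {t : ℝ}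
    (ht : 0 < t) : EnergyL2 m := (memLp_energyGaussian_const hm hs hν b ht).toLp _

lemma integrable_star_amplitude_gaussian_mul (hm : 0 < m) (hs : s ^ 2 = 1) (hν : ∀ b, 0 ≤ ν b)
    (b : Fin 2) {t : ℝ} (ht : 0 < t) (φ : EnergyL2 m) :
    Integrable (fun E => star (amplitude s m E b) *
      ((gaussian (ν b) t (momentum m E) : ℂ) * φ E)) (energyMeasure m) := by
  have h := memLp_energyGaussian hm hs b (a := ν b) (by linarith [hν b]) ht
  refine (L2.integrable_inner (𝕜 := ℂ) (h.toLp _) φ).congr ?_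
  filter_upwards [h.coeFn_toLp] with E hE
  rw [hE, RCLike.inner_apply, map_mul, Complex.conj_ofReal, mul_comm, mul_assoc]
  rfl

lemma inner_energyGaussian (hm : 0 < m) (hs : s ^ 2 = 1) (hν : ∀ b, 0 ≤ ν b)
    (b : Fin 2) {t : ℝ} (ht : 0 < t) (φ : EnergyL2 m) :
    inner ℂ (energyGaussian hm hs hν b ht) φ = ((t ^ (-ν b - 1) : ℝ) : ℂ) *
      ∫ E, star (amplitude s m E b) * ((gaussian (ν b) t⁻¹ (momentum m E) : ℂ) * φ E)
        ∂(energyMeasure m) := by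
  rw [L2.inner_def, ← integral_const_mul]
  refine integral_congr_ae ?_
  filter_upwards [(memLp_energyGaussian_const hm hs hν b ht).coeFn_toLp] with E hE
  rw [energyGaussian, hE, RCLike.inner_apply, map_mul, map_mul, Complex.conj_ofReal,
    Complex.conj_ofReal, mul_comm]
  simp only [starRingEnd_apply]; ring

lemma radialL2_eq_zero (hn : 1 ≤ n) (hν : ∀ b, 0 ≤ ν b) {f : RadialL2 n}
    (h : ∀ b t, 0 < t →
      ∫ r, (gaussian (radialExp n (ν b)) t r : ℂ) * f r b ∂(radialMeasure n) = 0) : f = 0 := by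
  have hf : Measurable f := (Lp.stronglyMeasurable f).measurable
  have hb : ∀ b, ∀ᵐ r ∂(radialMeasure n), f r b = 0 := fun b =>
    ae_eq_zero_of_integral_radial_gaussian (q := radialExp n (ν b)) (t₀ := 1)
      ((EuclideanSpace.proj (𝕜 := ℂ) b).continuous.measurable.comp hf)
      (fun t ht => integrable_gaussian_mul_apply hn hν b (by linarith) f)
      fun t ht => h b t (by linarith)
  refine (Lp.eq_zero_iff_ae_eq_zero).2 ?_
  filter_upwards [ae_all_iff.2 hb] with r hr
  ext b; exact hr b

lemma energyL2_eq_zero (hm : 0 < m) (hs : s ^ 2 = 1) (hν : ∀ b, 0 ≤ ν b) {φ : EnergyL2 m}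
    (h : ∀ b t, 0 < t → ∫ E, star (amplitude s m E b) *
      ((gaussian (ν b) t (momentum m E) : ℂ) * φ E) ∂(energyMeasure m) = 0) : φ = 0 :=
  (Lp.eq_zero_iff_ae_eq_zero).2 <| ae_eq_zero_of_integral_star_amplitude hm hs (t₀ := 1)
    (Lp.stronglyMeasurable φ).measurable
    (fun b t ht => integrable_star_amplitude_gaussian_mul hm hs hν b (by linarith) φ)
    fun b t ht => h b t (by linarith)

/-- The exponents may differ: besides the Gram matrices, this computes the shifted Gaussians of
`integral_ladder`. -/
lemma integral_gaussian_mul_gaussian (hn : 1 ≤ n) {μ μ' ν₀ t u : ℝ} (hν : -1 < ν₀) (ht : 0 < t)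
    (hu : 0 < u) (h : μ + μ' + n = 2 * ν₀ + 2) :
    ∫ r, (gaussian μ t r : ℂ) * (gaussian μ' u r : ℂ) ∂(radialMeasure n) =
      (gaussMoment ν₀ (t + u) : ℂ) := by
  rw [← integral_gaussian_radialMeasure hn hν (add_pos ht hu) h, ← integral_complex_ofReal]
  refine integral_congr_ae ?_
  filter_upwards [ae_radialMeasure_pos] with r hr
  rw [← Complex.ofReal_mul, gaussian_mul_gaussian hr]

lemma integrable_gaussian_mul_gaussian (hn : 1 ≤ n) {μ μ' t u : ℝ} (ht : 0 < t)
    (hu : 0 < u) (h : 0 < μ + μ' + n) :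
    Integrable (fun r => (gaussian μ t r : ℂ) * (gaussian μ' u r : ℂ)) (radialMeasure n) := by
  refine (integrable_gaussian_radialMeasure (q := μ + μ') hn (by linarith)
    (add_pos ht hu)).ofReal.congr ?_
  filter_upwards [ae_radialMeasure_pos] with r hr
  simp only [Complex.coe_algebraMap]
  rw [← Complex.ofReal_mul, gaussian_mul_gaussian hr]

lemma gram_radialGaussian (hn : 1 ≤ n) (hν : ∀ b, 0 ≤ ν b) (b c : Fin 2) {t u : ℝ} (ht : 0 < t)
    (hu : 0 < u) : inner ℂ (radialGaussian hn hν b ht) (radialGaussian hn hν c hu) =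
      if b = c then (gaussMoment (ν b) (t + u) : ℂ) else 0 := by
  rw [inner_radialGaussian]
  have : (fun r => (gaussian (radialExp n (ν b)) t r : ℂ) * radialGaussian hn hν c hu r b)
      =ᵐ[radialMeasure n] fun r => if b = c then (gaussian (radialExp n (ν b)) t r : ℂ) *
        (gaussian (radialExp n (ν c)) u r : ℂ) else 0 := by
    filter_upwards [(memLp_radialGaussian hn hν c hu).coeFn_toLp] with r hr
    rw [radialGaussian, hr, PiLp.single_apply]
    split_ifs <;> simp
  rw [integral_congr_ae this]
  split_ifs with h
  · subst h
    exact integral_gaussian_mul_gaussian hn (by linarith [hν b]) ht hu (by unfold radialExp; ring)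
  · simp

/-- The transform inverts the parameters, so the moment is taken at `t⁻¹ + u⁻¹`; the prefactors turn
it into the moment at `t + u`, as on the radial side. -/
lemma gram_energyGaussian (hm : 0 < m) (hs : s ^ 2 = 1) (hν : ∀ b, 0 ≤ ν b) (b c : Fin 2)
    {t u : ℝ} (ht : 0 < t) (hu : 0 < u) :
    inner ℂ (energyGaussian hm hs hν b ht) (energyGaussian hm hs hν c hu) =
      if b = c then (gaussMoment (ν b) (t + u) : ℂ) else 0 := by
  have ht' := inv_pos.2 ht
  have hu' := inv_pos.2 hu
  rw [inner_energyGaussian]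
  have : (fun E => star (amplitude s m E b) * ((gaussian (ν b) t⁻¹ (momentum m E) : ℂ) *
      energyGaussian hm hs hν c hu E)) =ᵐ[energyMeasure m] fun E =>
      ((u ^ (-ν c - 1) : ℝ) : ℂ) * (star (amplitude s m E b) * (amplitude s m E c *
        ((gaussian (ν b) t⁻¹ (momentum m E) : ℂ) * (gaussian (ν c) u⁻¹ (momentum m E) : ℂ)))) := by
    filter_upwards [(memLp_energyGaussian_const hm hs hν c hu).coeFn_toLp] with E hE
    rw [energyGaussian, hE]; ring
  rw [integral_congr_ae this, integral_const_mul, integral_star_amplitude_mul hm hs b c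
    (g := fun p => (gaussian (ν b) t⁻¹ p : ℂ) * (gaussian (ν c) u⁻¹ p : ℂ))
    (integrable_gaussian_mul_gaussian (by norm_num) ht' hu'
      (by push_cast; linarith [hν b, hν c]))]
  split_ifs with h
  · subst h
    rw [integral_gaussian_mul_gaussian (by norm_num) (ν₀ := ν b) (by linarith [hν b]) ht' hu'
      (by push_cast; ring), ← gaussMoment_inv_add_inv ht hu]
    push_cast; ring
  · simp

/-- The unitary transform, characterized by its action on Gaussians. -/
theorem exists_unitary (hn : 1 ≤ n) (hm : 0 < m) (hs : s ^ 2 = 1) (hν : ∀ b, 0 ≤ ν b) :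
    ∃ P : RadialL2 n ≃ₗᵢ[ℂ] EnergyL2 m, ∀ b t, 0 < t → ∀ f : RadialL2 n,
      ∫ r, (gaussian (radialExp n (ν b)) t r : ℂ) * f r b ∂(radialMeasure n) =
        ((t ^ (-ν b - 1) : ℝ) : ℂ) * ∫ E, star (amplitude s m E b) *
          ((gaussian (ν b) t⁻¹ (momentum m E) : ℂ) * P f E) ∂(energyMeasure m) := by
  obtain ⟨P, hP⟩ := exists_linearIsometryEquiv_of_gram
    (e := fun i : Fin 2 × {t : ℝ // 0 < t} => radialGaussian hn hν i.1 i.2.2)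
    (e' := fun i : Fin 2 × {t : ℝ // 0 < t} => energyGaussian hm hs hν i.1 i.2.2)
    (fun f hf => radialL2_eq_zero hn hν fun b t ht => by
      rw [← inner_radialGaussian hn hν b ht]; exact hf (b, ⟨t, ht⟩))
    (fun φ hφ => energyL2_eq_zero hm hs hν fun b t ht => by
      -- The family member of index `t⁻¹` is the one whose Gaussian has parameter `t`.
      have h := hφ (b, ⟨t⁻¹, inv_pos.2 ht⟩)
      rw [inner_energyGaussian hm hs hν b (inv_pos.2 ht), inv_inv, mul_eq_zero,
        Complex.ofReal_eq_zero] at h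
      exact h.resolve_left (Real.rpow_pos_of_pos (inv_pos.2 ht) _).ne')
    (fun i j => by
      rw [gram_energyGaussian hm hs hν i.1 j.1 i.2.2 j.2.2,
        gram_radialGaussian hn hν i.1 j.1 i.2.2 j.2.2])
  refine ⟨P, fun b t ht f => ?_⟩
  rw [← inner_radialGaussian hn hν b ht, ← inner_energyGaussian hm hs hν b ht,
    ← hP (b, ⟨t, ht⟩), P.inner_map_map]

end Families

/-! ### The integral kernel and its Gaussian bounds. -/

section Kernel

variable {n : ℕ} {ν : Fin 2 → ℝ} {s m : ℝ}

/-- The components `F_k`, `G_k` of the generalized eigenfunctions. -/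
def wave (n : ℕ) (ν : Fin 2 → ℝ) (s m : ℝ) (b : Fin 2) (E r : ℝ) : ℂ :=
  amplitude s m E b *
    ((r ^ ((2 - (n : ℝ)) / 2) * besselJ (ν b) (momentum m E * r) : ℝ) : ℂ)

lemma measurable_wave (b : Fin 2) : Measurable fun z : ℝ × ℝ => wave n ν s m b z.1 z.2 := by
  have h1 : Measurable fun z : ℝ × ℝ => amplitude s m z.1 b :=
    (measurable_amplitude b).comp measurable_fst
  have h2 : Measurable fun z : ℝ × ℝ => besselJ (ν b) (momentum m z.1 * z.2) :=
    (measurable_besselJ _).comp ((measurable_momentum.comp measurable_fst).mul measurable_snd)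
  have h3 : Measurable fun z : ℝ × ℝ => z.2 ^ ((2 - (n : ℝ)) / 2) := by fun_prop
  exact h1.mul (Complex.measurable_ofReal.comp (h3.mul h2))

/-- The constant in the small argument bounds of the Bessel function. -/
def besselBound (ν R : ℝ) : ℝ := (2 ^ ν * Real.Gamma (ν + 1))⁻¹ * Real.exp (R ^ 2 / 2)

/-- Splits the kernel into a product when one variable is bounded. The decaying factor in `x`, paid
for by `exp(R²/2)` in the constant, is a Gaussian that can be paired with an `L²` function. The
factor in `y` grows, and a Gaussian of parameter larger than `R²/2` absorbs it. -/
lemma abs_besselJ_mul_le {a R x y : ℝ} (ha : 0 ≤ a) (hx : 0 < x) (hxR : x ≤ R) (hy : 0 < y) :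
    |besselJ a (y * x)| ≤ besselBound a R * gaussian a 1 x * gaussian a (-(R ^ 2 / 2)) y := by
  have hG := Real.Gamma_pos_of_pos (show 0 < a + 1 by positivity)
  refine (abs_besselJ_le ha (mul_pos hy hx).le).trans ?_
  rw [Real.div_rpow (by positivity) (by positivity), Real.mul_rpow hy.le hx.le]
  unfold besselBound gaussian
  calc y ^ a * x ^ a / 2 ^ a / Real.Gamma (a + 1) * Real.exp ((y * x) ^ 2 / 4)
      ≤ y ^ a * x ^ a / 2 ^ a / Real.Gamma (a + 1) *
          Real.exp (R ^ 2 / 2 + -(1 * x ^ 2 / 2) + -(-(R ^ 2 / 2) * y ^ 2 / 2)) := by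
        gcongr
        have : x ^ 2 ≤ R ^ 2 := by gcongr
        nlinarith [mul_le_mul_of_nonneg_left this (sq_nonneg y)]
    _ = _ := by
        rw [Real.exp_add, Real.exp_add]; field_simp

lemma abs_besselJ_mul_gaussian_le {a c R τ x y : ℝ} (ha : 0 ≤ a) (hx : 0 < x) (hxR : x ≤ R)
    (hy : 0 < y) : |besselJ a (y * x)| * gaussian c τ y ≤
      besselBound a R * gaussian a 1 x * gaussian (a + c) (τ - R ^ 2 / 2) y := by
  refine (mul_le_mul_of_nonneg_right (abs_besselJ_mul_le ha hx hxR hy)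
    (gaussian_nonneg hy.le)).trans_eq ?_
  rw [mul_assoc, gaussian_mul_gaussian hy]
  congr 2; ring

lemma norm_wave_le (hm : 0 < m) (hs : s ^ 2 = 1) {E : ℝ} (hE : m < |E|) (b : Fin 2) {r : ℝ}
    (hr : 0 < r) :
    ‖wave n ν s m b E r‖ ≤ r ^ ((2 - (n : ℝ)) / 2) * |besselJ (ν b) (momentum m E * r)| := by
  unfold wave
  rw [norm_mul, Complex.norm_real, norm_mul, Real.norm_of_nonneg (Real.rpow_nonneg hr.le _),
    Real.norm_eq_abs]
  exact mul_le_of_le_one_left (by positivity) (norm_amplitude_le hm hs hE b)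

lemma rpow_mul_gaussian_eq_radial {a t r : ℝ} (hr : 0 < r) :
    r ^ ((2 - (n : ℝ)) / 2) * gaussian a t r = gaussian (radialExp n a) t r :=
  rpow_mul_gaussian hr

/-- Weber's integral with respect to the radial measure. -/
lemma integral_besselJ_mul_radial_gaussian (hn : 1 ≤ n) {a τ y : ℝ} (ha : 0 ≤ a) (hτ : 0 < τ)
    (hy : 0 < y) :
    ∫ x, x ^ ((2 - (n : ℝ)) / 2) * besselJ a (x * y) * gaussian (radialExp n a) τ x
      ∂(radialMeasure n) = τ ^ (-a - 1) * gaussian a τ⁻¹ y := by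
  rw [← integral_besselJ_mul_gaussian ha hτ hy, integral_radialMeasure]
  refine setIntegral_congr_fun measurableSet_Ioi fun x hx => ?_
  have hx : 0 < x := hx
  simp only [smul_eq_mul]
  have h : x ^ (n - 1) * (x ^ ((2 - (n : ℝ)) / 2) * gaussian (radialExp n a) τ x) =
      gaussian (a + 1) τ x := by
    rw [rpow_mul_gaussian hx, pow_mul_gaussian hn hx]
    unfold radialExp
    congr 1; ring
  rw [← h]; ring

lemma integral_besselJ_mul_gaussian_radialMeasure_two {a τ y : ℝ} (ha : 0 ≤ a) (hτ : 0 < τ)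
    (hy : 0 < y) :
    ∫ x, besselJ a (x * y) * gaussian a τ x ∂(radialMeasure 2) =
      τ ^ (-a - 1) * gaussian a τ⁻¹ y := by
  rw [← integral_besselJ_mul_radial_gaussian (n := 2) (by norm_num) ha hτ hy]
  simp [radialExp]

lemma integrable_besselJ_mul_gaussian {a c τ y : ℝ} (ha : 0 ≤ a) (hc : 0 ≤ c) (hy : 0 < y)
    (hτ : y ^ 2 / 2 < τ) :
    Integrable (fun x => besselJ a (x * y) * gaussian c τ x) (radialMeasure 2) := by
  refine ((integrable_gaussian_radialMeasure (n := 2) (q := a + c) (a := τ - y ^ 2 / 2)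
    (by norm_num) (by push_cast; linarith) (by linarith)).const_mul
      (besselBound a y * gaussian a 1 y)).mono' ?_ ?_
  · exact ((((measurable_besselJ a).comp (measurable_id.mul_const y))).mul
      (measurable_gaussian c τ)).aestronglyMeasurable
  · filter_upwards [ae_radialMeasure_pos] with x hx
    rw [norm_mul, Real.norm_eq_abs, Real.norm_of_nonneg (gaussian_nonneg hx.le)]
    exact abs_besselJ_mul_gaussian_le ha hy le_rfl hx

end Kernel

/-! ### Truncations in `L²` and passage to the limit. -/

section Truncation

/-- Truncations converge in `L²`. -/
lemma tendsto_eLpNorm_indicator_sub {X F : Type*} [MeasurableSpace X] {μ : Measure X}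
    [NormedAddCommGroup F] {f : X → F} (hfm : StronglyMeasurable f) (hf : MemLp f 2 μ) {S : ℝ → Set X}
    (hS : ∀ R, MeasurableSet (S R)) (hev : ∀ᵐ x ∂μ, ∀ᶠ R in atTop, x ∈ S R) :
    Tendsto (fun R => eLpNorm (fun x => (S R).indicator f x - f x) 2 μ) atTop (𝓝 0) := by
  have h2 : ∀ R, eLpNorm (fun x => (S R).indicator f x - f x) 2 μ =
      (∫⁻ x, ‖(S R).indicator f x - f x‖ₑ ^ (2 : ℝ) ∂μ) ^ (1 / 2 : ℝ) := fun R => by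
    rw [eLpNorm_eq_lintegral_rpow_enorm_toReal (by norm_num) (by norm_num)]
    simp
  simp_rw [h2]
  have h3 : Tendsto (fun R => ∫⁻ x, ‖(S R).indicator f x - f x‖ₑ ^ (2 : ℝ) ∂μ) atTop
      (𝓝 (∫⁻ _, 0 ∂μ)) := by
    refine tendsto_lintegral_filter_of_dominated_convergence (fun x => ‖f x‖ₑ ^ (2 : ℝ))
      (Eventually.of_forall fun R => ?_) (Eventually.of_forall fun R => ?_) ?_ ?_
    · exact ((hfm.indicator (hS R)).sub hfm).enorm.pow_const _
    · refine Eventually.of_forall fun x => ?_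
      gcongr
      by_cases hx : x ∈ S R <;> simp [hx]
    · have := lintegral_rpow_enorm_lt_top_of_eLpNorm_lt_top (p := 2) (by norm_num) (by norm_num)
        hf.2
      simpa using this.ne
    · filter_upwards [hev] with x hx
      refine tendsto_const_nhds.congr' ?_
      filter_upwards [hx] with R hR
      simp [hR]
  rw [lintegral_zero] at h3
  have := h3.ennrpow_const (1 / 2 : ℝ)
  rwa [ENNReal.zero_rpow_of_pos (by norm_num)] at this

/-- The truncation of an `L²` function to a measurable set. -/
def truncLp {X F : Type*} [MeasurableSpace X] {μ : Measure X} [NormedAddCommGroup F]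
    {S : Set X} (hS : MeasurableSet S) (f : Lp F 2 μ) : Lp F 2 μ :=
  ((Lp.memLp f).indicator hS).toLp _

lemma coeFn_truncLp {X F : Type*} [MeasurableSpace X] {μ : Measure X} [NormedAddCommGroup F]
    {S : Set X} (hS : MeasurableSet S) (f : Lp F 2 μ) : truncLp hS f =ᵐ[μ] S.indicator f :=
  MemLp.coeFn_toLp _

/-- If `T R` agrees with the image under an isometry of the truncation to `S R`, then `T R`
converges to the image of the whole function. -/
lemma tendsto_eLpNorm_sub_of_ae_eq_trunc {X Y F G : Type*} [MeasurableSpace X] [MeasurableSpace Y]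
    {μ : Measure X} {κ : Measure Y} [NormedAddCommGroup F] [NormedSpace ℂ F]
    [NormedAddCommGroup G] [NormedSpace ℂ G] (U : Lp F 2 μ →ₗᵢ[ℂ] Lp G 2 κ) (f : Lp F 2 μ)
    {S : ℝ → Set X} (hS : ∀ R, MeasurableSet (S R)) (hev : ∀ᵐ x ∂μ, ∀ᶠ R in atTop, x ∈ S R)
    {T : ℝ → Y → G} (hT : ∀ R, T R =ᵐ[κ] U (truncLp (hS R) f)) :
    Tendsto (fun R => eLpNorm (fun y => T R y - U f y) 2 κ) atTop (𝓝 0) := by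
  refine (tendsto_eLpNorm_indicator_sub (Lp.stronglyMeasurable f) (Lp.memLp f) hS hev).congr fun R => ?_
  have h1 : eLpNorm (fun y => T R y - U f y) 2 κ = ‖U (truncLp (hS R) f - f)‖ₑ := by
    rw [map_sub, Lp.enorm_def]
    refine eLpNorm_congr_ae ?_
    filter_upwards [hT R, Lp.coeFn_sub (U (truncLp (hS R) f)) (U f)] with y h1 h2
    rw [h1, h2, Pi.sub_apply]
  rw [h1, ← ofReal_norm, U.norm_map, ofReal_norm, Lp.enorm_def]
  refine eLpNorm_congr_ae ?_
  filter_upwards [coeFn_truncLp (hS R) f, Lp.coeFn_sub (truncLp (hS R) f) f] with x h1 h2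
  rw [h2, Pi.sub_apply, h1]

end Truncation

/-! ### The truncated integral computes the unitary operator. -/

section Identification

variable {n : ℕ} {ν : Fin 2 → ℝ} {s m : ℝ}

lemma integrableOn_wave_mul (hn : 1 ≤ n) (hm : 0 < m) (hs : s ^ 2 = 1) (hν : ∀ b, 0 ≤ ν b)
    (f : RadialL2 n) {E : ℝ} (hE : m < |E|) (R : ℝ) (b : Fin 2) :
    IntegrableOn (fun r => wave n ν s m b E r * f r b) (Ioc 0 R) (radialMeasure n) := by
  have hp := momentum_pos hm hE
  have hf : Measurable fun r => f r b :=
    (EuclideanSpace.proj (𝕜 := ℂ) b).continuous.measurable.comp (Lp.stronglyMeasurable f).measurable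
  refine Integrable.mono' (g := fun r => (besselBound (ν b) R * gaussian (ν b) (-(R ^ 2 / 2))
    (momentum m E)) * ‖(gaussian (radialExp n (ν b)) 1 r : ℂ) * f r b‖)
    ((integrable_gaussian_mul_apply hn hν b one_pos f).norm.const_mul _).integrableOn
    (((measurable_wave b).comp measurable_prodMk_left).mul hf).aestronglyMeasurable ?_
  filter_upwards [ae_restrict_mem measurableSet_Ioc] with r hr
  have hr0 : 0 < r := hr.1
  rw [norm_mul, norm_mul, ← mul_assoc, Complex.norm_real,
    Real.norm_of_nonneg (gaussian_nonneg hr0.le)]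
  refine mul_le_mul_of_nonneg_right ((norm_wave_le hm hs hE b hr0).trans ?_) (norm_nonneg _)
  rw [← rpow_mul_gaussian_eq_radial hr0]
  refine (mul_le_mul_of_nonneg_left (abs_besselJ_mul_le (hν b) hr0 hr.2 hp)
    (Real.rpow_nonneg hr0.le _)).trans_eq ?_
  ring

/-- Licence for Fubini: with `r ≤ R` and `τ > R²/2` the integrand is dominated by a product of
integrable functions of `E` and of `r`. -/
lemma integrable_prod_wave_mul (hn : 1 ≤ n) (hm : 0 < m) (hs : s ^ 2 = 1) (hν : ∀ b, 0 ≤ ν b)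
    (f : RadialL2 n) {R τ : ℝ} (hτ : R ^ 2 / 2 < τ) (b c : Fin 2) :
    Integrable (fun z : ℝ × ℝ => star (amplitude s m z.1 b) *
      ((gaussian (ν b) τ (momentum m z.1) : ℂ) * (wave n ν s m c z.1 z.2 * f z.2 c)))
      ((energyMeasure m).prod ((radialMeasure n).restrict (Ioc 0 R))) := by
  have hf : Measurable fun r => f r c :=
    (EuclideanSpace.proj (𝕜 := ℂ) c).continuous.measurable.comp (Lp.stronglyMeasurable f).measurable
  have hG1 : Integrable (fun E => gaussian (ν c + ν b) (τ - R ^ 2 / 2) (momentum m E))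
      (energyMeasure m) := integrable_comp_momentum hm (integrable_gaussian_radialMeasure
        (by norm_num) (by push_cast; linarith [hν b, hν c]) (by linarith))
  have hG2 : IntegrableOn (fun r => besselBound (ν c) R *
      ‖(gaussian (radialExp n (ν c)) 1 r : ℂ) * f r c‖) (Ioc 0 R) (radialMeasure n) :=
    ((integrable_gaussian_mul_apply hn hν c one_pos f).norm.const_mul _).integrableOn
  refine (hG1.mul_prod hG2).mono' ?_ ?_
  · refine Measurable.aestronglyMeasurable ?_
    exact ((measurable_star_amplitude b).comp measurable_fst).mul
      ((Complex.measurable_ofReal.comp (((measurable_gaussian _ _).comp measurable_momentum).comp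
        measurable_fst)).mul ((measurable_wave c).mul (hf.comp measurable_snd)))
  · filter_upwards [Measure.quasiMeasurePreserving_fst.ae ae_energyMeasure_lt_abs,
      Measure.quasiMeasurePreserving_snd.ae (ae_restrict_mem measurableSet_Ioc)] with z hE hr
    have hp := momentum_pos hm hE
    have hr0 : 0 < z.2 := hr.1
    have hg := gaussian_nonneg (ν := ν b) (t := τ) hp.le
    rw [norm_mul, norm_mul, norm_mul, norm_mul, norm_star, Complex.norm_real, Complex.norm_real,
      Real.norm_of_nonneg hg, Real.norm_of_nonneg (gaussian_nonneg hr0.le),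
      ← rpow_mul_gaussian_eq_radial hr0]
    calc ‖amplitude s m z.1 b‖ * (gaussian (ν b) τ (momentum m z.1) *
          (‖wave n ν s m c z.1 z.2‖ * ‖f z.2 c‖))
        ≤ 1 * (gaussian (ν b) τ (momentum m z.1) *
          ((z.2 ^ ((2 - (n : ℝ)) / 2) * |besselJ (ν c) (momentum m z.1 * z.2)|) * ‖f z.2 c‖)) := by
          gcongr
          · exact norm_amplitude_le hm hs hE b
          · exact norm_wave_le hm hs hE c hr0
      _ = (z.2 ^ ((2 - (n : ℝ)) / 2) * ‖f z.2 c‖) * (|besselJ (ν c) (momentum m z.1 * z.2)| *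
          gaussian (ν b) τ (momentum m z.1)) := by ring
      _ ≤ (z.2 ^ ((2 - (n : ℝ)) / 2) * ‖f z.2 c‖) * (besselBound (ν c) R * gaussian (ν c) 1 z.2 *
          gaussian (ν c + ν b) (τ - R ^ 2 / 2) (momentum m z.1)) := by
          refine mul_le_mul_of_nonneg_left ?_ (by positivity)
          exact abs_besselJ_mul_gaussian_le (hν c) hr0 hr.2 hp
      _ = _ := by ring

/-- The truncated transform. -/
def truncWave (n : ℕ) (ν : Fin 2 → ℝ) (s m R : ℝ) (f : ℝ → EuclideanSpace ℂ (Fin 2)) (E : ℝ) : ℂ :=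
  ∫ r in Ioc 0 R, ∑ b, wave n ν s m b E r * f r b ∂(radialMeasure n)

lemma measurable_truncWave (f : RadialL2 n) (R : ℝ) : Measurable (truncWave n ν s m R f) := by
  have hf : ∀ b, Measurable fun r => f r b := fun b =>
    (EuclideanSpace.proj (𝕜 := ℂ) b).continuous.measurable.comp (Lp.stronglyMeasurable f).measurable
  have : Measurable fun z : ℝ × ℝ => ∑ b, wave n ν s m b z.1 z.2 * f z.2 b :=
    Finset.measurable_sum _ fun b _ => (measurable_wave b).mul ((hf b).comp measurable_snd)
  exact this.stronglyMeasurable.integral_prod_right.measurable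

/-- Folding kills the mixed components, and the diagonal one is Weber's integral in the momentum
variable. -/
lemma integral_star_amplitude_wave_mul (hm : 0 < m) (hs : s ^ 2 = 1)
    (hν : ∀ b, 0 ≤ ν b) {R τ r : ℝ} (hτ : R ^ 2 / 2 < τ) (hr : r ∈ Ioc 0 R) (b c : Fin 2) (z : ℂ) :
    ∫ E, star (amplitude s m E b) * ((gaussian (ν b) τ (momentum m E) : ℂ) *
      (wave n ν s m c E r * z)) ∂(energyMeasure m) =
    if b = c then ((τ ^ (-ν b - 1) : ℝ) : ℂ) * ((gaussian (radialExp n (ν b)) τ⁻¹ r : ℂ) * z)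
      else 0 := by
  have hr0 : 0 < r := hr.1
  have hτ0 : 0 < τ := by nlinarith [sq_nonneg R]
  have hτr : r ^ 2 / 2 < τ := lt_of_le_of_lt (by have := hr.2; gcongr) hτ
  have h1 : ∀ E, star (amplitude s m E b) * ((gaussian (ν b) τ (momentum m E) : ℂ) *
      (wave n ν s m c E r * z)) = (((r ^ ((2 - (n : ℝ)) / 2) : ℝ) : ℂ) * z) *
      (star (amplitude s m E b) * (amplitude s m E c *
        ((besselJ (ν c) (momentum m E * r) * gaussian (ν b) τ (momentum m E) : ℝ) : ℂ))) := by
    intro E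
    unfold wave; push_cast; ring
  simp_rw [h1]
  rw [integral_const_mul, integral_star_amplitude_mul hm hs b c
    (g := fun p => ((besselJ (ν c) (p * r) * gaussian (ν b) τ p : ℝ) : ℂ))
    (integrable_besselJ_mul_gaussian (hν c) (hν b) hr0 hτr).ofReal]
  split_ifs with h
  · subst h
    rw [integral_complex_ofReal, integral_besselJ_mul_gaussian_radialMeasure_two (hν b) hτ0 hr0,
      ← rpow_mul_gaussian_eq_radial hr0]
    push_cast; ring
  · simp

lemma star_amplitude_mul_truncWave (hn : 1 ≤ n) (hm : 0 < m) (hs : s ^ 2 = 1) (hν : ∀ b, 0 ≤ ν b)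
    (f : RadialL2 n) (R τ : ℝ) (b : Fin 2) {E : ℝ} (hE : m < |E|) :
    star (amplitude s m E b) * ((gaussian (ν b) τ (momentum m E) : ℂ) * truncWave n ν s m R f E) =
      ∑ c, ∫ r in Ioc 0 R, star (amplitude s m E b) * ((gaussian (ν b) τ (momentum m E) : ℂ) *
        (wave n ν s m c E r * f r c)) ∂(radialMeasure n) := by
  unfold truncWave
  rw [integral_finsetSum _ fun c _ => integrableOn_wave_mul hn hm hs hν f hE R c]
  simp_rw [integral_const_mul, Finset.mul_sum]

/-- The truncated transform is the unitary transform of the truncated spinor. -/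
theorem truncWave_ae_eq (hn : 1 ≤ n) (hm : 0 < m) (hs : s ^ 2 = 1) (hν : ∀ b, 0 ≤ ν b)
    {P : RadialL2 n ≃ₗᵢ[ℂ] EnergyL2 m}
    (hP : ∀ b t, 0 < t → ∀ f : RadialL2 n,
      ∫ r, (gaussian (radialExp n (ν b)) t r : ℂ) * f r b ∂(radialMeasure n) =
        ((t ^ (-ν b - 1) : ℝ) : ℂ) * ∫ E, star (amplitude s m E b) *
          ((gaussian (ν b) t⁻¹ (momentum m E) : ℂ) * P f E) ∂(energyMeasure m))
    (f : RadialL2 n) (R : ℝ) :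
    truncWave n ν s m R f =ᵐ[energyMeasure m] P (truncLp measurableSet_Ioc (S := Ioc 0 R) f) := by
  set fR := truncLp measurableSet_Ioc (S := Ioc 0 R) f with hfR
  -- Only parameters beyond a threshold depending on `R` are available, which is all that Laplace
  -- uniqueness requires.
  have hτR : ∀ {τ : ℝ}, R ^ 2 / 2 + 1 ≤ τ → R ^ 2 / 2 < τ := fun h => by linarith
  have hK := fun τ (hτ : R ^ 2 / 2 < τ) b c => integrable_prod_wave_mul hn hm hs hν f hτ b c
  have hcongr : ∀ b τ, (fun E => star (amplitude s m E b) *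
      ((gaussian (ν b) τ (momentum m E) : ℂ) * truncWave n ν s m R f E)) =ᵐ[energyMeasure m]
      fun E => ∑ c, ∫ r in Ioc 0 R, star (amplitude s m E b) *
        ((gaussian (ν b) τ (momentum m E) : ℂ) *
          (wave n ν s m c E r * f r c)) ∂(radialMeasure n) := by
    intro b τ
    filter_upwards [ae_energyMeasure_lt_abs] with E hE
    exact star_amplitude_mul_truncWave hn hm hs hν f R τ b hE
  have hTint : ∀ b τ, R ^ 2 / 2 + 1 ≤ τ → Integrable (fun E => star (amplitude s m E b) *
      ((gaussian (ν b) τ (momentum m E) : ℂ) * truncWave n ν s m R f E)) (energyMeasure m) := by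
    intro b τ hτ
    exact (integrable_finsetSum _ fun c _ =>
      (hK τ (hτR hτ) b c).integral_prod_left).congr (hcongr b τ).symm
  have hPint : ∀ b τ, R ^ 2 / 2 + 1 ≤ τ → Integrable (fun E => star (amplitude s m E b) *
      ((gaussian (ν b) τ (momentum m E) : ℂ) * P fR E)) (energyMeasure m) := fun b τ hτ =>
    integrable_star_amplitude_gaussian_mul hm hs hν b (by nlinarith [sq_nonneg R]) _
  have hTval : ∀ b τ, R ^ 2 / 2 + 1 ≤ τ → ∫ E, star (amplitude s m E b) *
      ((gaussian (ν b) τ (momentum m E) : ℂ) * truncWave n ν s m R f E) ∂(energyMeasure m) =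
      ((τ ^ (-ν b - 1) : ℝ) : ℂ) * ∫ r in Ioc 0 R,
        (gaussian (radialExp n (ν b)) τ⁻¹ r : ℂ) * f r b ∂(radialMeasure n) := by
    intro b τ hτ
    rw [integral_congr_ae (hcongr b τ), integral_finsetSum _ fun c _ =>
      (hK τ (hτR hτ) b c).integral_prod_left]
    have : ∀ c, ∫ E, ∫ r in Ioc 0 R, star (amplitude s m E b) *
        ((gaussian (ν b) τ (momentum m E) : ℂ) * (wave n ν s m c E r * f r c))
          ∂(radialMeasure n) ∂(energyMeasure m) = if b = c then ((τ ^ (-ν b - 1) : ℝ) : ℂ) *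
        ∫ r in Ioc 0 R, (gaussian (radialExp n (ν b)) τ⁻¹ r : ℂ) * f r b ∂(radialMeasure n)
        else 0 := by
      intro c
      rw [integral_integral_swap (hK τ (hτR hτ) b c),
        setIntegral_congr_fun measurableSet_Ioc fun r hr =>
          integral_star_amplitude_wave_mul hm hs hν (hτR hτ) hr b c (f r c)]
      split_ifs with h
      · subst h
        rw [integral_const_mul]
      · simp
    simp only [this, Finset.sum_ite_eq, Finset.mem_univ, if_true]
  have hPval : ∀ b τ, R ^ 2 / 2 + 1 ≤ τ → ∫ E, star (amplitude s m E b) *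
      ((gaussian (ν b) τ (momentum m E) : ℂ) * P fR E) ∂(energyMeasure m) =
      ((τ ^ (-ν b - 1) : ℝ) : ℂ) * ∫ r in Ioc 0 R,
        (gaussian (radialExp n (ν b)) τ⁻¹ r : ℂ) * f r b ∂(radialMeasure n) := by
    intro b τ hτ
    have hτ0 : 0 < τ := by nlinarith [sq_nonneg R]
    have h := hP b τ⁻¹ (inv_pos.2 hτ0) fR
    have h2 : ∫ r, (gaussian (radialExp n (ν b)) τ⁻¹ r : ℂ) * fR r b ∂(radialMeasure n) =
        ∫ r in Ioc 0 R, (gaussian (radialExp n (ν b)) τ⁻¹ r : ℂ) * f r b ∂(radialMeasure n) := by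
      rw [← integral_indicator measurableSet_Ioc]
      refine integral_congr_ae ?_
      filter_upwards [coeFn_truncLp (measurableSet_Ioc (a := 0) (b := R)) f] with r hr
      rw [hfR, hr]
      by_cases hrR : r ∈ Ioc 0 R <;> simp [hrR]
    rw [h2, inv_inv] at h
    -- `hP` is used at `τ⁻¹`, and its prefactor cancels against `τ^(-ν-1)`.
    rw [h, ← mul_assoc, ← Complex.ofReal_mul, ← Real.mul_rpow hτ0.le (inv_pos.2 hτ0).le,
      mul_inv_cancel₀ hτ0.ne', Real.one_rpow, Complex.ofReal_one, one_mul]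
  have hsub : ∀ b τ E, star (amplitude s m E b) * ((gaussian (ν b) τ (momentum m E) : ℂ) *
      (truncWave n ν s m R f E - P fR E)) = star (amplitude s m E b) *
      ((gaussian (ν b) τ (momentum m E) : ℂ) * truncWave n ν s m R f E) -
      star (amplitude s m E b) * ((gaussian (ν b) τ (momentum m E) : ℂ) * P fR E) := by
    intros; ring
  have := ae_eq_zero_of_integral_star_amplitude hm hs (ν := ν) (t₀ := R ^ 2 / 2 + 1)
    (φ := fun E => truncWave n ν s m R f E - P fR E)
    ((measurable_truncWave f R).sub (Lp.stronglyMeasurable _).measurable)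
    (fun b τ hτ => by
      simp_rw [hsub]; exact (hTint b τ hτ).sub (hPint b τ hτ))
    (fun b τ hτ => by
      simp_rw [hsub]
      rw [integral_sub (hTint b τ hτ) (hPint b τ hτ), hTval b τ hτ, hPval b τ hτ, sub_self])
  filter_upwards [this] with E hE
  exact sub_eq_zero.1 hE

end Identification

/-! ### The truncated inverse integral computes the inverse operator. -/

section InverseIdentification

variable {n : ℕ} {ν : Fin 2 → ℝ} {s m : ℝ}

lemma momentum_le_of_mem_Icc {R E : ℝ} (hE : E ∈ Icc (-R) R) : momentum m E ≤ R := by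
  have hR : |E| ≤ R := abs_le.2 hE
  refine (Real.sqrt_le_sqrt (sub_le_self _ (sq_nonneg m))).trans ?_
  rwa [Real.sqrt_sq_eq_abs]

lemma integrable_gaussian_momentum_mul (hm : 0 < m) (φ : EnergyL2 m) {a : ℝ} (ha : -1 < a) {t : ℝ}
    (ht : 0 < t) : Integrable (fun E => (gaussian a t (momentum m E) : ℂ) * φ E)
      (energyMeasure m) := by
  have hL := memLp_two_of_gaussian_sq (n := 2) (q := a) (by norm_num) (by push_cast; linarith) ht
  have hme : Measurable fun E => (gaussian a t (momentum m E) : ℂ) :=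
    Complex.measurable_ofReal.comp ((measurable_gaussian _ _).comp measurable_momentum)
  have hg : MemLp (fun E => (gaussian a t (momentum m E) : ℂ)) 2 (energyMeasure m) :=
    (memLp_two_iff_integrable_sq_norm hme.aestronglyMeasurable).2
      (integrable_comp_momentum hm (g := fun p => ‖(gaussian a t p : ℂ)‖ ^ 2)
        ((memLp_two_iff_integrable_sq_norm hL.1).1 hL))
  exact hg.integrable_mul (Lp.memLp φ)

lemma integrableOn_star_wave_mul (hm : 0 < m) (hs : s ^ 2 = 1) (hν : ∀ b, 0 ≤ ν b)
    (φ : EnergyL2 m) {r : ℝ} (hr : 0 < r) (R : ℝ) (b : Fin 2) :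
    IntegrableOn (fun E => star (wave n ν s m b E r) * φ E) (Icc (-R) R) (energyMeasure m) := by
  have hφ : Measurable φ := (Lp.stronglyMeasurable φ).measurable
  refine Integrable.mono' (g := fun E => (r ^ ((2 - (n : ℝ)) / 2) * (besselBound (ν b) R *
    gaussian (ν b) (-(R ^ 2 / 2)) r)) * ‖(gaussian (ν b) 1 (momentum m E) : ℂ) * φ E‖)
    ((integrable_gaussian_momentum_mul hm φ (by linarith [hν b]) one_pos).norm.const_mul
      _).integrableOn
    ((continuous_star.measurable.comp ((measurable_wave b).comp measurable_prodMk_right)).mul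
      hφ).aestronglyMeasurable ?_
  filter_upwards [ae_restrict_mem measurableSet_Icc, ae_restrict_of_ae ae_energyMeasure_lt_abs]
    with E hER hE
  have hp := momentum_pos hm hE
  rw [norm_mul, norm_mul, norm_star, ← mul_assoc, Complex.norm_real,
    Real.norm_of_nonneg (gaussian_nonneg hp.le)]
  refine mul_le_mul_of_nonneg_right ((norm_wave_le hm hs hE b hr).trans ?_) (norm_nonneg _)
  have := abs_besselJ_mul_le (hν b) hp (momentum_le_of_mem_Icc hER) hr
  rw [mul_comm] at this
  refine (mul_le_mul_of_nonneg_left this (Real.rpow_nonneg hr.le _)).trans_eq ?_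
  ring

/-- The roles are exchanged: now `p ≤ |E| ≤ R` is the bounded variable and the Gaussian absorbs the
growth in `r`. -/
lemma integrable_prod_star_wave_mul (hn : 1 ≤ n) (hm : 0 < m) (hs : s ^ 2 = 1)
    (hν : ∀ b, 0 ≤ ν b) (φ : EnergyL2 m) {R τ : ℝ} (hτ : R ^ 2 / 2 < τ) (b : Fin 2) :
    Integrable (fun z : ℝ × ℝ => (gaussian (radialExp n (ν b)) τ z.1 : ℂ) *
      (star (wave n ν s m b z.2 z.1) * φ z.2))
      ((radialMeasure n).prod ((energyMeasure m).restrict (Icc (-R) R))) := by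
  have hφ : Measurable φ := (Lp.stronglyMeasurable φ).measurable
  have hG1 : Integrable (gaussian (2 * radialExp n (ν b)) (τ - R ^ 2 / 2)) (radialMeasure n) :=
    integrable_gaussian_radialMeasure hn (by unfold radialExp; linarith [hν b]) (by linarith)
  have hG2 : IntegrableOn (fun E => besselBound (ν b) R *
      ‖(gaussian (ν b) 1 (momentum m E) : ℂ) * φ E‖) (Icc (-R) R) (energyMeasure m) :=
    ((integrable_gaussian_momentum_mul hm φ (by linarith [hν b]) one_pos).norm.const_mul
      _).integrableOn
  refine (hG1.mul_prod hG2).mono' ?_ ?_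
  · refine Measurable.aestronglyMeasurable ?_
    exact ((Complex.measurable_ofReal.comp (measurable_gaussian _ _)).comp measurable_fst).mul
      ((continuous_star.measurable.comp ((measurable_wave b).comp measurable_swap)).mul
        (hφ.comp measurable_snd))
  · filter_upwards [Measure.quasiMeasurePreserving_fst.ae ae_radialMeasure_pos,
      Measure.quasiMeasurePreserving_snd.ae (ae_restrict_mem measurableSet_Icc),
      Measure.quasiMeasurePreserving_snd.ae (ae_restrict_of_ae ae_energyMeasure_lt_abs)]
      with z hr hER hE
    have hp := momentum_pos hm hE
    have hg := gaussian_nonneg (ν := radialExp n (ν b)) (t := τ) hr.le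
    have hJ := abs_besselJ_mul_gaussian_le (c := radialExp n (ν b)) (τ := τ) (hν b) hp
      (momentum_le_of_mem_Icc hER) hr
    rw [mul_comm z.1] at hJ
    rw [norm_mul, norm_mul, norm_mul, norm_star, Complex.norm_real, Complex.norm_real,
      Real.norm_of_nonneg hg, Real.norm_of_nonneg (gaussian_nonneg hp.le)]
    have e : gaussian (2 * radialExp n (ν b)) (τ - R ^ 2 / 2) z.1 = z.1 ^ ((2 - (n : ℝ)) / 2) *
        gaussian (ν b + radialExp n (ν b)) (τ - R ^ 2 / 2) z.1 := by
      rw [rpow_mul_gaussian hr]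
      congr 1; unfold radialExp; ring
    rw [e]
    calc gaussian (radialExp n (ν b)) τ z.1 * (‖wave n ν s m b z.2 z.1‖ * ‖φ z.2‖)
        ≤ gaussian (radialExp n (ν b)) τ z.1 *
          ((z.1 ^ ((2 - (n : ℝ)) / 2) * |besselJ (ν b) (momentum m z.2 * z.1)|) * ‖φ z.2‖) := by
          gcongr
          exact norm_wave_le hm hs hE b hr
      _ = (z.1 ^ ((2 - (n : ℝ)) / 2) * ‖φ z.2‖) * (|besselJ (ν b) (momentum m z.2 * z.1)| *
          gaussian (radialExp n (ν b)) τ z.1) := by ring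
      _ ≤ (z.1 ^ ((2 - (n : ℝ)) / 2) * ‖φ z.2‖) * (besselBound (ν b) R *
          gaussian (ν b) 1 (momentum m z.2) *
          gaussian (ν b + radialExp n (ν b)) (τ - R ^ 2 / 2) z.1) :=
          mul_le_mul_of_nonneg_left hJ (by positivity)
      _ = _ := by ring

lemma integral_radial_gaussian_star_wave_mul (hn : 1 ≤ n) (hm : 0 < m) (hν : ∀ b, 0 ≤ ν b)
    {τ E : ℝ} (hτ : 0 < τ) (hE : m < |E|) (b : Fin 2) (z : ℂ) :
    ∫ r, (gaussian (radialExp n (ν b)) τ r : ℂ) * (star (wave n ν s m b E r) * z)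
      ∂(radialMeasure n) = ((τ ^ (-ν b - 1) : ℝ) : ℂ) *
        (star (amplitude s m E b) * ((gaussian (ν b) τ⁻¹ (momentum m E) : ℂ) * z)) := by
  have h1 : ∀ r : ℝ, (gaussian (radialExp n (ν b)) τ r : ℂ) * (star (wave n ν s m b E r) * z) =
      (star (amplitude s m E b) * z) * ((r ^ ((2 - (n : ℝ)) / 2) *
        besselJ (ν b) (r * momentum m E) * gaussian (radialExp n (ν b)) τ r : ℝ) : ℂ) := by
    intro r
    unfold wave
    rw [star_mul', mul_comm (momentum m E)]
    simp only [Complex.star_def, Complex.conj_ofReal]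
    push_cast; ring
  simp_rw [h1]
  rw [integral_const_mul, integral_complex_ofReal,
    integral_besselJ_mul_radial_gaussian hn (hν b) hτ (momentum_pos hm hE)]
  push_cast; ring

/-- The components of the truncated inverse transform are those of the inverse of the unitary
transform at the truncated function. -/
theorem integral_star_wave_mul_ae_eq (hn : 1 ≤ n) (hm : 0 < m) (hs : s ^ 2 = 1)
    (hν : ∀ b, 0 ≤ ν b) {P : RadialL2 n ≃ₗᵢ[ℂ] EnergyL2 m}
    (hP : ∀ b t, 0 < t → ∀ f : RadialL2 n,
      ∫ r, (gaussian (radialExp n (ν b)) t r : ℂ) * f r b ∂(radialMeasure n) =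
        ((t ^ (-ν b - 1) : ℝ) : ℂ) * ∫ E, star (amplitude s m E b) *
          ((gaussian (ν b) t⁻¹ (momentum m E) : ℂ) * P f E) ∂(energyMeasure m))
    (φ : EnergyL2 m) (R : ℝ) (b : Fin 2) :
    ∀ᵐ r ∂(radialMeasure n), ∫ E in Icc (-R) R, star (wave n ν s m b E r) * φ E
        ∂(energyMeasure m) =
      P.symm (truncLp measurableSet_Icc (S := Icc (-R) R) φ) r b := by
  set φR := truncLp measurableSet_Icc (S := Icc (-R) R) φ with hφR
  set f := P.symm φR with hf
  have hPf : P f = φR := P.apply_symm_apply φR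
  have hφ : Measurable φ := (Lp.stronglyMeasurable φ).measurable
  have hτR : ∀ {τ : ℝ}, R ^ 2 / 2 + 1 ≤ τ → R ^ 2 / 2 < τ := fun h => by linarith
  have hτ0 : ∀ {τ : ℝ}, R ^ 2 / 2 + 1 ≤ τ → 0 < τ := fun h => by nlinarith [sq_nonneg R]
  have hK := fun τ (hτ : R ^ 2 / 2 < τ) =>
    integrable_prod_star_wave_mul (s := s) hn hm hs hν φ hτ b
  set h : ℝ → ℂ := fun r => ∫ E in Icc (-R) R, star (wave n ν s m b E r) * φ E
    ∂(energyMeasure m) with hh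
  have hhm : Measurable h := by
    have : Measurable fun z : ℝ × ℝ => star (wave n ν s m b z.2 z.1) * φ z.2 :=
      (continuous_star.measurable.comp ((measurable_wave b).comp measurable_swap)).mul
        (hφ.comp measurable_snd)
    exact this.stronglyMeasurable.integral_prod_right.measurable
  have hhint : ∀ τ, R ^ 2 / 2 + 1 ≤ τ → Integrable
      (fun r => (gaussian (radialExp n (ν b)) τ r : ℂ) * h r) (radialMeasure n) := fun τ hτ => by
    simp_rw [hh, ← integral_const_mul]
    exact (hK τ (hτR hτ)).integral_prod_left
  have hfint : ∀ τ, R ^ 2 / 2 + 1 ≤ τ → Integrable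
      (fun r => (gaussian (radialExp n (ν b)) τ r : ℂ) * f r b) (radialMeasure n) := fun τ hτ =>
    integrable_gaussian_mul_apply hn hν b (hτ0 hτ) f
  have hval : ∀ τ, R ^ 2 / 2 + 1 ≤ τ →
      ∫ r, (gaussian (radialExp n (ν b)) τ r : ℂ) * h r ∂(radialMeasure n) =
      ∫ r, (gaussian (radialExp n (ν b)) τ r : ℂ) * f r b ∂(radialMeasure n) := by
    intro τ hτ
    rw [hP b τ (hτ0 hτ) f, hPf]
    simp_rw [hh, ← integral_const_mul]
    -- After the swap the inner integral over `r` is Weber's integral, and what remains is the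
    -- energy pairing with the truncated function.
    rw [integral_integral_swap (hK τ (hτR hτ)), ← integral_indicator measurableSet_Icc]
    refine integral_congr_ae ?_
    filter_upwards [ae_energyMeasure_lt_abs,
      coeFn_truncLp (measurableSet_Icc (a := -R) (b := R)) φ] with E hE hER
    rw [hφR, hER]
    by_cases hR : E ∈ Icc (-R) R
    · rw [indicator_of_mem hR, indicator_of_mem hR,
        integral_radial_gaussian_star_wave_mul hn hm hν (hτ0 hτ) hE]
    · rw [indicator_of_notMem hR, indicator_of_notMem hR]; simp
  have := ae_eq_zero_of_integral_radial_gaussian (n := n) (q := radialExp n (ν b))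
    (t₀ := R ^ 2 / 2 + 1) (h := fun r => h r - f r b)
    (hhm.sub ((EuclideanSpace.proj (𝕜 := ℂ) b).continuous.measurable.comp
      (Lp.stronglyMeasurable f).measurable))
    (fun τ hτ => by simp_rw [mul_sub]; exact (hhint τ hτ).sub (hfint τ hτ))
    (fun τ hτ => by
      simp_rw [mul_sub]
      rw [integral_sub (hhint τ hτ) (hfint τ hτ), hval τ hτ, sub_self])
  filter_upwards [this] with r hr
  exact sub_eq_zero.1 hr

end InverseIdentification

/-! ### Cutoffs on the logarithmic scale. -/

section LogCutoff

/-- A smooth cutoff on the logarithmic scale, equal to `1` for `|log r| ≤ N`. -/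
def logBump : ContDiffBump (0 : ℝ) := ⟨1, 2, one_pos, one_lt_two⟩

lemma abs_logBump_le (x : ℝ) : |logBump x| ≤ 1 := by
  rw [abs_of_nonneg logBump.nonneg]; exact logBump.le_one

lemma logBump_eq_zero {x : ℝ} (hx : 2 ≤ |x|) : logBump x = 0 :=
  logBump.zero_of_le_dist (by rw [Real.dist_eq, sub_zero]; exact hx)

lemma exists_deriv_logBump_bound : ∃ C, 0 ≤ C ∧ ∀ x, |deriv logBump x| ≤ C := by
  have hc : Continuous (deriv logBump) := (logBump.contDiff (n := 1)).continuous_deriv le_rfl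
  obtain ⟨C, hC⟩ := logBump.hasCompactSupport.deriv.exists_bound_of_continuous hc
  exact ⟨C, (norm_nonneg _).trans (hC 0), hC⟩

lemma deriv_logBump_eq_zero {x : ℝ} (hx : 2 < |x|) : deriv logBump x = 0 := by
  have : logBump =ᶠ[𝓝 x] fun _ => (0 : ℝ) := by
    filter_upwards [(continuous_abs.continuousAt (x := x)).eventually (lt_mem_nhds hx)] with y hy
    exact logBump_eq_zero hy.le
  rw [this.deriv_eq]; simp

lemma tendsto_logBump (x : ℝ) :
    Tendsto (fun N : ℕ => logBump (x / (N + 1))) atTop (𝓝 1) := by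
  have h : Tendsto (fun N : ℕ => x / ((N : ℝ) + 1)) atTop (𝓝 0) := by
    simpa [div_eq_mul_inv] using (tendsto_one_div_add_atTop_nhds_zero_nat (𝕜 := ℝ)).const_mul x
  have := (logBump.continuous.tendsto 0).comp h
  rwa [show logBump 0 = 1 from logBump.one_of_mem_closedBall (by simp [logBump])] at this

variable {u v : ℝ → ℂ} {e : ℝ → ℝ}

/-- The cutoff confines the test function to `[exp(-2N), exp(2N)]`, away from both `0` and `∞`, at
the price of a derivative of size `1/(N r)`. -/
lemma HasWeakDeriv.integral_logBump_mul (huv : HasWeakDeriv u v) (he : ContDiffOn ℝ ∞ e (Ioi 0))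
    {N : ℝ} (hN : 0 < N) :
    ∫ r in Ioi (0 : ℝ), (logBump (Real.log r / N) * e r) • v r =
      -∫ r in Ioi (0 : ℝ), (deriv logBump (Real.log r / N) / (N * r) * e r +
        logBump (Real.log r / N) * deriv e r) • u r := by
  set η : ℝ → ℝ := fun r => if 0 < r then logBump (Real.log r / N) * e r else 0 with hη
  have hηpos : ∀ {r}, 0 < r → η =ᶠ[𝓝 r] fun r => logBump (Real.log r / N) * e r := fun hr => by
    filter_upwards [Ioi_mem_nhds hr] with y hy using if_pos hy
  have hsupp : Function.support η ⊆ Icc (Real.exp (-(2 * N))) (Real.exp (2 * N)) := by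
    intro r hr
    rw [Function.mem_support] at hr
    have hr0 : 0 < r := by
      by_contra h; exact hr (if_neg h)
    rw [hη] at hr
    simp only [if_pos hr0] at hr
    have h1 : |Real.log r / N| < 2 := by
      by_contra h
      exact hr (by rw [logBump_eq_zero (not_lt.1 h), zero_mul])
    rw [abs_div, abs_of_pos hN, div_lt_iff₀ hN, abs_lt] at h1
    exact ⟨(Real.le_log_iff_exp_le hr0).1 (by linarith), (Real.log_le_iff_le_exp hr0).1 h1.2.le⟩
  have htsupp : tsupport η ⊆ Icc (Real.exp (-(2 * N))) (Real.exp (2 * N)) :=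
    closure_minimal hsupp isClosed_Icc
  have hIoi : tsupport η ⊆ Ioi 0 := fun r hr =>
    lt_of_lt_of_le (Real.exp_pos _) (htsupp hr).1
  have hsmooth : ContDiff ℝ ∞ η := by
    refine contDiff_iff_contDiffAt.2 fun r => ?_
    by_cases hr : 0 < r
    · have hlog : ContDiffAt ℝ ∞ (fun r => Real.log r / N) r :=
        (Real.contDiffAt_log.2 hr.ne').div_const N
      have := (logBump.contDiffAt (n := ⊤) (x := Real.log r / N)).comp r hlog
      exact (this.mul (he.contDiffAt (Ioi_mem_nhds hr))).congr_of_eventuallyEq (hηpos hr)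
    · have : r ∉ tsupport η := fun h => hr (hIoi h)
      exact contDiffAt_const.congr_of_eventuallyEq (notMem_tsupport_iff_eventuallyEq.1 this)
  have hder : ∀ {r}, 0 < r → deriv η r = deriv logBump (Real.log r / N) / (N * r) * e r +
      logBump (Real.log r / N) * deriv e r := by
    intro r hr
    have h1 : HasDerivAt (fun r => Real.log r / N) (r⁻¹ / N) r :=
      (Real.hasDerivAt_log hr.ne').div_const N
    have h2 : HasDerivAt logBump (deriv logBump (Real.log r / N)) (Real.log r / N) :=
      ((logBump.contDiff (n := 1)).differentiable one_ne_zero _).hasDerivAt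
    have h3 : HasDerivAt e (deriv e r) r :=
      ((he.contDiffAt (Ioi_mem_nhds hr)).differentiableAt (by simp)).hasDerivAt
    rw [(hηpos hr).deriv_eq]
    refine ((h2.comp r h1).mul h3).deriv.trans ?_
    simp only [Function.comp_apply]
    field_simp
  have key := huv.2.2 η hsmooth
    (HasCompactSupport.of_support_subset_isCompact isCompact_Icc hsupp) hIoi
  have key2 : ∫ r in Ioi (0 : ℝ), deriv η r • u r = ∫ r in Ioi (0 : ℝ),
      (deriv logBump (Real.log r / N) / (N * r) * e r +
        logBump (Real.log r / N) * deriv e r) • u r :=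
    setIntegral_congr_fun measurableSet_Ioi fun r (hr : 0 < r) => by rw [hder hr]
  rw [← key2, key, neg_neg]
  refine setIntegral_congr_fun measurableSet_Ioi fun r (hr : 0 < r) => ?_
  simp only [hη, if_pos hr]

end LogCutoff

/-! ### Derivatives of Gaussians and the vanishing boundary term. -/

section WeakDerivative

lemma contDiffOn_gaussian (a t : ℝ) : ContDiffOn ℝ ∞ (gaussian a t) (Ioi 0) := fun r hr => by
  have h1 : ContDiffAt ℝ ∞ (fun x : ℝ => x ^ a) r :=
    Real.contDiffAt_rpow_const_of_ne (ne_of_gt hr)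
  have h2 : ContDiff ℝ ∞ fun x : ℝ => Real.exp (-(t * x ^ 2 / 2)) := by fun_prop
  exact (h1.mul h2.contDiffAt).contDiffWithinAt

lemma deriv_gaussian {a t r : ℝ} (hr : 0 < r) :
    deriv (gaussian a t) r = (a / r - t * r) * gaussian a t r := by
  have h1 : HasDerivAt (fun x : ℝ => x ^ a) (a * r ^ (a - 1)) r :=
    Real.hasDerivAt_rpow_const (Or.inl hr.ne')
  have h2 : HasDerivAt (fun x : ℝ => Real.exp (-(t * x ^ 2 / 2)))
      (Real.exp (-(t * r ^ 2 / 2)) * (-(t * (2 * r) / 2))) r := by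
    have : HasDerivAt (fun x : ℝ => -(t * x ^ 2 / 2)) (-(t * (2 * r) / 2)) r := by
      simpa using (((hasDerivAt_pow 2 r).const_mul t).div_const 2).fun_neg
    exact this.exp
  have := (h1.mul h2).deriv
  unfold gaussian
  refine Eq.trans this ?_
  rw [Real.rpow_sub_one hr.ne']
  field_simp
  ring

/-- Use `log r ≤ r` and complete the square in the exponent. -/
lemma gaussian_le_exp {a t r : ℝ} (ha : 0 ≤ a) (ht : 0 < t) (hr : 0 < r) :
    gaussian a t r ≤ Real.exp (a ^ 2 / (2 * t)) := by
  unfold gaussian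
  rw [Real.rpow_def_of_pos hr, ← Real.exp_add]
  refine Real.exp_le_exp.2 ?_
  have h1 : Real.log r * a ≤ r * a := mul_le_mul_of_nonneg_right (Real.log_le_self hr.le) ha
  have h2 : a ^ 2 / (2 * t) - (r * a - t * r ^ 2 / 2) = (a - t * r) ^ 2 / (2 * t) := by
    field_simp; ring
  have h3 : 0 ≤ (a - t * r) ^ 2 / (2 * t) := by positivity
  linarith

variable {n : ℕ}

/-- The boundary term produced by the logarithmic cutoff vanishes in the limit; at `ν = 0` this
uses that points have zero capacity in the plane. -/
lemma tendsto_integral_deriv_logBump {u : ℝ → ℂ} (hn : 1 ≤ n) {ν t : ℝ} (hν : 0 ≤ ν) (ht : 0 < t)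
    (hu : MemLp u 2 (radialMeasure n)) :
    Tendsto (fun N : ℕ => ∫ r in Ioi (0 : ℝ), (deriv logBump (Real.log r / (N + 1)) /
      ((N + 1) * r) * gaussian (ν + n / 2) t r) • u r) atTop (𝓝 0) := by
  obtain ⟨C, hC0, hC⟩ := exists_deriv_logBump_bound
  set K : ℝ := Real.exp ((2 * ν) ^ 2 / (2 * (2 * t))) with hK
  have hu2 : IntegrableOn (fun r => r ^ (n - 1) * ‖u r‖ ^ 2) (Ioi 0) :=
    integrable_radialMeasure_iff.1 ((memLp_two_iff_integrable_sq_norm hu.1).1 hu)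
  set U : ℝ := ∫ r in Ioi (0 : ℝ), r ^ (n - 1) * ‖u r‖ ^ 2 with hU
  -- A weighted form of Cauchy–Schwarz. With `M = N + 1`, the support carries `∫ dr/r = 4M`, so the
  -- weight `√M` balances `K/√M · 4M` against `√M · U`; the factor `C/M` leaves `1/√M`.
  have hbound : ∀ N : ℕ, ‖∫ r in Ioi (0 : ℝ), (deriv logBump (Real.log r / (N + 1)) /
      ((N + 1) * r) * gaussian (ν + n / 2) t r) • u r‖ ≤ C * (4 * K + U) * (√((N : ℝ) + 1))⁻¹ := by
    intro N
    set M : ℝ := (N : ℝ) + 1 with hM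
    have hM0 : 0 < M := by positivity
    set I : Set ℝ := Icc (Real.exp (-(2 * M))) (Real.exp (2 * M)) with hI
    have hI0 : I ⊆ Ioi 0 := fun r hr => lt_of_lt_of_le (Real.exp_pos _) hr.1
    have hle : Real.exp (-(2 * M)) ≤ Real.exp (2 * M) := Real.exp_le_exp.2 (by linarith)
    have hinvint : IntegrableOn (fun r : ℝ => r⁻¹) I :=
      (continuousOn_inv₀.mono fun r hr => (hI0 hr).ne').integrableOn_Icc
    have hinv : ∫ r in I, r⁻¹ = 4 * M := by
      rw [hI, integral_Icc_eq_integral_Ioc, ← intervalIntegral.integral_of_le hle,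
        integral_inv_of_pos (Real.exp_pos _) (Real.exp_pos _), ← Real.exp_sub, Real.log_exp]
      ring
    have hg : IntegrableOn (fun r => C / M * (K / √M * I.indicator (fun r => r⁻¹) r +
        √M * (r ^ (n - 1) * ‖u r‖ ^ 2))) (Ioi 0) := by
      refine Integrable.const_mul (Integrable.add (Integrable.const_mul ?_ _)
        (hu2.const_mul _)) _
      exact ((integrable_indicator_iff measurableSet_Icc).2 hinvint).integrableOn
    have hpt : ∀ r ∈ Ioi (0 : ℝ), ‖(deriv logBump (Real.log r / M) /
        (M * r) * gaussian (ν + n / 2) t r) • u r‖ ≤ C / M * (K / √M * I.indicator (fun r => r⁻¹) r +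
        √M * (r ^ (n - 1) * ‖u r‖ ^ 2)) := by
      intro r hr
      have hr0 : 0 < r := hr
      by_cases hrI : r ∈ I
      · rw [indicator_of_mem hrI, norm_smul, norm_mul, norm_div, Real.norm_eq_abs,
          Real.norm_of_nonneg (show 0 ≤ M * r by positivity),
          Real.norm_of_nonneg (gaussian_nonneg hr0.le)]
        set X := r⁻¹ * gaussian (ν + n / 2) t r with hX
        have hX0 : 0 ≤ X := mul_nonneg (inv_nonneg.2 hr0.le) (gaussian_nonneg hr0.le)
        -- The square has power `r^(2ν+n-2)`. At `ν = 0` this is exactly `r⁻¹ r^(n-1)`, which is why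
        -- a logarithmic cutoff is needed.
        have hX2 : X ^ 2 ≤ K * r⁻¹ * r ^ (n - 1) := by
          have e1 : gaussian (ν + n / 2) t r ^ 2 = r ^ (n - 1) * r * gaussian (2 * ν) (2 * t) r := by
            rw [sq, gaussian_mul_gaussian hr0, ← pow_succ, Nat.sub_add_cancel hn,
              ← Real.rpow_natCast, rpow_mul_gaussian hr0]
            congr 1 <;> ring
          rw [hX, mul_pow, e1]
          have := gaussian_le_exp (a := 2 * ν) (t := 2 * t) (by positivity) (by positivity) hr0
          calc r⁻¹ ^ 2 * (r ^ (n - 1) * r * gaussian (2 * ν) (2 * t) r)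
              = r⁻¹ * r ^ (n - 1) * gaussian (2 * ν) (2 * t) r := by field_simp
            _ ≤ r⁻¹ * r ^ (n - 1) * K := by gcongr
            _ = _ := by ring
        have hXu : X * ‖u r‖ ≤ K / √M * r⁻¹ + √M * (r ^ (n - 1) * ‖u r‖ ^ 2) := by
          have hs : 0 < √M := Real.sqrt_pos.2 hM0
          have hpw : 0 < r ^ (n - 1) := by positivity
          have h1 : (X / r ^ (n - 1)) ^ 2 * r ^ (n - 1) ≤ K * r⁻¹ := by
            rw [div_pow, div_mul_eq_mul_div, div_le_iff₀ (by positivity)]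
            calc X ^ 2 * r ^ (n - 1) ≤ K * r⁻¹ * r ^ (n - 1) * r ^ (n - 1) := by gcongr
              _ = _ := by ring
          have h2 : X * ‖u r‖ ≤ ((X / r ^ (n - 1)) ^ 2 / √M + √M * ‖u r‖ ^ 2) * r ^ (n - 1) := by
            have h3 : X = (X / r ^ (n - 1)) * r ^ (n - 1) := by field_simp
            have h4 : (X / r ^ (n - 1)) * ‖u r‖ ≤ (X / r ^ (n - 1)) ^ 2 / √M + √M * ‖u r‖ ^ 2 := by
              rw [← sub_nonneg]
              have : (X / r ^ (n - 1)) ^ 2 / √M + √M * ‖u r‖ ^ 2 - (X / r ^ (n - 1)) * ‖u r‖ =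
                  (((X / r ^ (n - 1)) - √M * ‖u r‖) ^ 2 + (X / r ^ (n - 1)) * (√M * ‖u r‖)) / √M := by
                field_simp; ring
              rw [this]; positivity
            calc X * ‖u r‖ = (X / r ^ (n - 1)) * ‖u r‖ * r ^ (n - 1) := by
                  field_simp
              _ ≤ _ := by gcongr
          refine h2.trans ?_
          calc ((X / r ^ (n - 1)) ^ 2 / √M + √M * ‖u r‖ ^ 2) * r ^ (n - 1)
              = ((X / r ^ (n - 1)) ^ 2 * r ^ (n - 1)) / √M + √M * (r ^ (n - 1) * ‖u r‖ ^ 2) := by ring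
            _ ≤ (K * r⁻¹) / √M + √M * (r ^ (n - 1) * ‖u r‖ ^ 2) := by gcongr
            _ = _ := by ring
        calc |deriv logBump (Real.log r / M)| / (M * r) * gaussian (ν + n / 2) t r * ‖u r‖
            = |deriv logBump (Real.log r / M)| / M * (X * ‖u r‖) := by
              rw [hX]; field_simp
          _ ≤ C / M * (K / √M * r⁻¹ + √M * (r ^ (n - 1) * ‖u r‖ ^ 2)) := by
              gcongr
              exact hC _
      · have h2 : 2 < |Real.log r / M| := by
          by_contra h
          rw [not_lt, abs_div, abs_of_pos hM0, div_le_iff₀ hM0, abs_le] at h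
          exact hrI ⟨(Real.le_log_iff_exp_le hr0).1 (by linarith [h.1]),
            (Real.log_le_iff_le_exp hr0).1 h.2⟩
        rw [deriv_logBump_eq_zero h2, indicator_of_notMem hrI]
        simp only [zero_div, zero_mul, zero_smul, norm_zero]
        positivity
    refine (norm_integral_le_of_norm_le hg ((ae_restrict_iff' measurableSet_Ioi).2
      (Eventually.of_forall hpt))).trans_eq ?_
    have hii : ∫ r in Ioi (0 : ℝ), I.indicator (fun r => r⁻¹) r = 4 * M := by
      rw [setIntegral_indicator measurableSet_Icc, inter_eq_self_of_subset_right hI0, hinv]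
    rw [integral_const_mul, integral_add, integral_const_mul, integral_const_mul, hii, ← hU]
    · rw [show C / M * (K / √M * (4 * M) + √M * U) =
          C * (4 * K) * (M / M) * (√M)⁻¹ + C * U * (√M / M) by ring, Real.sqrt_div_self',
        div_self hM0.ne']
      ring
    · exact ((integrable_indicator_iff measurableSet_Icc).2 hinvint).integrableOn.const_mul _
    · exact hu2.const_mul _
  refine squeeze_zero_norm hbound ?_
  have h1 : Tendsto (fun N : ℕ => √((N : ℝ) + 1)) atTop atTop :=
    Real.tendsto_sqrt_atTop.comp (tendsto_atTop_add_const_right _ _ tendsto_natCast_atTop_atTop)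
  simpa using h1.inv_tendsto_atTop.const_mul (C * (4 * K + U))

end WeakDerivative

/-! ### Integration by parts against Gaussians. -/

section IntegrationByParts

variable {n : ℕ}

/-- The threshold on `q` is the condition that, after the weight `r^(n-1)` is split off, the
Gaussian is square integrable at `0`. -/
lemma integrableOn_gaussian_smul (hn : 1 ≤ n) {q t : ℝ} {h : ℝ → ℂ}
    (hh : MemLp h 2 (radialMeasure n)) (hq : (n : ℝ) / 2 - 1 < q) (ht : 0 < t) :
    IntegrableOn (fun r => gaussian q t r • h r) (Ioi 0) := by
  have h1 := (memLp_two_of_gaussian_sq (q := q - n + 1) hn (by linarith) ht).integrable_mul hh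
  refine (integrable_radialMeasure_iff.1 h1).congr_fun (fun r (hr : 0 < r) => ?_) measurableSet_Ioi
  simp only [Pi.mul_apply]
  rw [Complex.real_smul, Complex.real_smul, ← mul_assoc, ← Complex.ofReal_mul,
    pow_mul_gaussian hn hr]
  congr 3; ring

lemma integral_radial_gaussian_mul (hn : 1 ≤ n) (ν t : ℝ) (c : ℝ → ℝ) (h : ℝ → ℂ) :
    ∫ r, ((c r * gaussian (radialExp n ν) t r : ℝ) : ℂ) * h r ∂(radialMeasure n) =
      ∫ r in Ioi (0 : ℝ), (c r * gaussian (ν + n / 2) t r) • h r := by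
  rw [integral_radialMeasure]
  refine setIntegral_congr_fun measurableSet_Ioi fun r (hr : 0 < r) => ?_
  have : gaussian (ν + n / 2) t r = r ^ (n - 1) * gaussian (radialExp n ν) t r := by
    rw [pow_mul_gaussian hn hr]; unfold radialExp; congr 1; ring
  simp only [this, Complex.real_smul]
  push_cast; ring

lemma integrableOn_bdd_mul_gaussian_smul (hn : 1 ≤ n) {q t C : ℝ} {h : ℝ → ℂ} {c : ℝ → ℝ}
    (hh : MemLp h 2 (radialMeasure n)) (hq : (n : ℝ) / 2 - 1 < q) (ht : 0 < t)
    (hc : Measurable c) (hC : ∀ r, 0 < r → |c r| ≤ C) :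
    IntegrableOn (fun r => (c r * gaussian q t r) • h r) (Ioi 0) := by
  have h1 := (integrableOn_gaussian_smul hn hh hq ht).bdd_smul (φ := c) C
    hc.aestronglyMeasurable ((ae_restrict_iff' measurableSet_Ioi).2
      (Eventually.of_forall fun r hr => hC r hr))
  refine IntegrableOn.congr_fun h1 (fun r _ => ?_) measurableSet_Ioi
  simp only [Pi.smul_apply', smul_smul]

lemma measurable_logBump_log (M : ℝ) : Measurable fun r => logBump (Real.log r / M) :=
  logBump.continuous.measurable.comp (Real.measurable_log.div_const M)

lemma measurable_deriv_logBump_log (M : ℝ) :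
    Measurable fun r => deriv logBump (Real.log r / M) :=
  (measurable_deriv _).comp (Real.measurable_log.div_const M)

lemma inv_le_exp_of_abs_log_le {M r : ℝ} (hM : 0 < M) (hr : 0 < r) (h : |Real.log r / M| ≤ 2) :
    r⁻¹ ≤ Real.exp (2 * M) := by
  rw [abs_div, abs_of_pos hM, div_le_iff₀ hM, abs_le] at h
  rw [← Real.exp_log (inv_pos.2 hr), Real.log_inv]
  exact Real.exp_le_exp.2 (by linarith [h.1])

/-- Integration by parts of a weakly differentiable function against a Gaussian, without boundary
terms. -/
theorem integral_gaussian_mul_weakDeriv (hn : 1 ≤ n) {u v : ℝ → ℂ} (huv : HasWeakDeriv u v)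
    {a ν t : ℝ} (hν : 0 ≤ ν) (ht : 0 < t) (ha : ν + n / 2 = a ∨ 0 < ν)
    (hu : MemLp u 2 (radialMeasure n))
    (hw : MemLp (fun r => v r + ((a / r : ℝ) : ℂ) * u r) 2 (radialMeasure n)) :
    ∫ r, (gaussian (radialExp n ν) t r : ℂ) * (v r + ((a / r : ℝ) : ℂ) * u r) ∂(radialMeasure n) =
      -∫ r, ((((ν + n / 2 - a) / r - t * r) * gaussian (radialExp n ν) t r : ℝ) : ℂ) * u r
        ∂(radialMeasure n) := by
  set α : ℝ := ν + n / 2 with hα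
  set w : ℝ → ℂ := fun r => v r + ((a / r : ℝ) : ℂ) * u r with hwdef
  have hα1 : (n : ℝ) / 2 - 1 < α := by linarith
  have hGw : IntegrableOn (fun r => gaussian α t r • w r) (Ioi 0) :=
    integrableOn_gaussian_smul hn hw hα1 ht
  have hDu : IntegrableOn (fun r => (((α - a) / r - t * r) * gaussian α t r) • u r) (Ioi 0) := by
    have h1 := (integrableOn_gaussian_smul hn hu (q := α + 1) (by linarith) ht).smul (-t)
    -- The `1/r` term is the delicate one: it is absent when `α = a`, and otherwise `ν > 0` keeps
    -- the exponent `α - 1` above `n/2 - 1`.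
    have h2 : IntegrableOn (fun r => (α - a) • (gaussian (α - 1) t r • u r)) (Ioi 0) := by
      rcases ha with h | h
      · simp only [h, sub_self, zero_smul]
        exact integrableOn_zero
      · exact (integrableOn_gaussian_smul hn hu (q := α - 1) (by linarith) ht).smul (α - a)
    refine (h2.add h1).congr_fun (fun r (hr : 0 < r) => ?_) measurableSet_Ioi
    have e1 : gaussian (α + 1) t r = r * gaussian α t r := by
      nth_rw 2 [← Real.rpow_one r]; rw [rpow_mul_gaussian hr, add_comm]
    have e2 : gaussian (α - 1) t r = r⁻¹ * gaussian α t r := by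
      rw [← Real.rpow_neg_one, rpow_mul_gaussian hr, sub_eq_neg_add]
    simp only [Pi.add_apply, Pi.smul_apply, e1, e2, smul_smul, ← add_smul]
    congr 1; ring
  have hstep : ∀ N : ℕ, ∫ r in Ioi (0 : ℝ),
      (logBump (Real.log r / (N + 1)) * gaussian α t r) • w r =
      -(∫ r in Ioi (0 : ℝ), (deriv logBump (Real.log r / (N + 1)) /
        ((N + 1) * r) * gaussian α t r) • u r) -
      ∫ r in Ioi (0 : ℝ), (logBump (Real.log r / (N + 1)) *
        (((α - a) / r - t * r) * gaussian α t r)) • u r := by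
    intro N
    set M : ℝ := (N : ℝ) + 1 with hM
    have hM0 : 0 < M := by positivity
    obtain ⟨C, hC0, hC⟩ := exists_deriv_logBump_bound
    -- For fixed `N` the cutoff keeps `r` away from `0`, so each piece is integrable on its own and
    -- the identity may be split. Only the combination `w`, not `v`, is known to be in `L²`.
    have hχr : ∀ r, 0 < r → |logBump (Real.log r / M) / r| ≤ Real.exp (2 * M) := by
      intro r hr
      by_cases h : |Real.log r / M| ≤ 2
      · rw [abs_div, abs_of_pos hr, div_eq_mul_inv]
        calc |logBump (Real.log r / M)| * r⁻¹ ≤ 1 * Real.exp (2 * M) := by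
              gcongr
              · exact abs_logBump_le _
              · exact inv_le_exp_of_abs_log_le hM0 hr h
          _ = _ := one_mul _
      · rw [logBump_eq_zero (not_le.1 h).le]; simp; positivity
    have hθr : ∀ r, 0 < r → |deriv logBump (Real.log r / M) / (M * r)| ≤
        C * M⁻¹ * Real.exp (2 * M) := by
      intro r hr
      by_cases h : |Real.log r / M| ≤ 2
      · rw [abs_div, abs_of_pos (mul_pos hM0 hr), div_eq_mul_inv, mul_inv, ← mul_assoc]
        gcongr
        · exact hC _
        · exact inv_le_exp_of_abs_log_le hM0 hr h
      · rw [deriv_logBump_eq_zero (not_le.1 h)]; simp; positivity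
    have i1 : IntegrableOn (fun r => (deriv logBump (Real.log r / M) / (M * r) *
        gaussian α t r) • u r) (Ioi 0) :=
      integrableOn_bdd_mul_gaussian_smul hn hu hα1 ht
        ((measurable_deriv_logBump_log M).div (measurable_id.const_mul M)) hθr
    have i2 : IntegrableOn (fun r => (logBump (Real.log r / M) / r * gaussian α t r) • u r)
        (Ioi 0) :=
      integrableOn_bdd_mul_gaussian_smul hn hu hα1 ht
        ((measurable_logBump_log M).div measurable_id) hχr
    have i3 : IntegrableOn (fun r => (logBump (Real.log r / M) * gaussian α t r) • w r) (Ioi 0) :=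
      integrableOn_bdd_mul_gaussian_smul hn hw hα1 ht (measurable_logBump_log M)
        fun r _ => abs_logBump_le _
    have i4 : IntegrableOn (fun r => (logBump (Real.log r / M) * gaussian (α + 1) t r) • u r)
        (Ioi 0) :=
      integrableOn_bdd_mul_gaussian_smul hn hu (by linarith) ht (measurable_logBump_log M)
        fun r _ => abs_logBump_le _
    have hlast : ∀ r ∈ Ioi (0 : ℝ), (α - a) • ((logBump (Real.log r / M) / r * gaussian α t r) • u r)
        - t • ((logBump (Real.log r / M) * gaussian (α + 1) t r) • u r) =
        (logBump (Real.log r / M) * (((α - a) / r - t * r) * gaussian α t r)) • u r := by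
      intro r hr
      have e1 : gaussian (α + 1) t r = r * gaussian α t r := by
        nth_rw 2 [← Real.rpow_one r]; rw [rpow_mul_gaussian hr, add_comm]
      simp only [e1, smul_smul, ← sub_smul]
      congr 1; ring
    have i6 : IntegrableOn (fun r => a • ((logBump (Real.log r / M) / r * gaussian α t r) • u r))
        (Ioi 0) := i2.smul a
    have i5 : IntegrableOn (fun r => (logBump (Real.log r / M) *
        (((α - a) / r - t * r) * gaussian α t r)) • u r) (Ioi 0) :=
      IntegrableOn.congr_fun ((i2.smul (α - a)).sub (i4.smul t)) hlast measurableSet_Ioi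
    have i7 : IntegrableOn (fun r => (logBump (Real.log r / M) *
        (((α - a) / r - t * r) * gaussian α t r)) • u r +
        a • ((logBump (Real.log r / M) / r * gaussian α t r) • u r)) (Ioi 0) := i5.add i6
    have key := huv.integral_logBump_mul (contDiffOn_gaussian α t) hM0
    have hl : ∀ r ∈ Ioi (0 : ℝ), (logBump (Real.log r / M) * gaussian α t r) • v r =
        (logBump (Real.log r / M) * gaussian α t r) • w r -
          a • ((logBump (Real.log r / M) / r * gaussian α t r) • u r) := by
      intro r hr
      simp only [hwdef, Complex.real_smul]
      push_cast; ring
    have hr' : ∀ r ∈ Ioi (0 : ℝ), (deriv logBump (Real.log r / M) / (M * r) * gaussian α t r +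
        logBump (Real.log r / M) * deriv (gaussian α t) r) • u r =
        (deriv logBump (Real.log r / M) / (M * r) * gaussian α t r) • u r +
        ((logBump (Real.log r / M) * (((α - a) / r - t * r) * gaussian α t r)) • u r +
          a • ((logBump (Real.log r / M) / r * gaussian α t r) • u r)) := by
      intro r hr
      rw [deriv_gaussian hr]
      simp only [smul_smul, ← add_smul]
      congr 1; ring
    rw [setIntegral_congr_fun measurableSet_Ioi hl, setIntegral_congr_fun measurableSet_Ioi hr',
      integral_sub i3 i6, integral_add i1 i7, integral_add i5 i6] at key
    linear_combination key
  have hlim1 : Tendsto (fun N : ℕ => ∫ r in Ioi (0 : ℝ),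
      (logBump (Real.log r / (N + 1)) * gaussian α t r) • w r) atTop
      (𝓝 (∫ r in Ioi (0 : ℝ), gaussian α t r • w r)) := by
    refine tendsto_integral_of_dominated_convergence (fun r => ‖gaussian α t r • w r‖)
      (fun N => ?_) hGw.norm (fun N => Eventually.of_forall fun r => ?_)
      (Eventually.of_forall fun r => ?_)
    · simp_rw [mul_smul]
      exact (measurable_logBump_log _).aestronglyMeasurable.smul hGw.1
    · rw [mul_smul, norm_smul]
      exact mul_le_of_le_one_left (norm_nonneg _) (abs_logBump_le _)
    · simp_rw [mul_smul]
      simpa using (tendsto_logBump (Real.log r)).smul_const (gaussian α t r • w r)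
  have hlim2 : Tendsto (fun N : ℕ => ∫ r in Ioi (0 : ℝ), (logBump (Real.log r / (N + 1)) *
        (((α - a) / r - t * r) * gaussian α t r)) • u r) atTop
      (𝓝 (∫ r in Ioi (0 : ℝ), (((α - a) / r - t * r) * gaussian α t r) • u r)) := by
    refine tendsto_integral_of_dominated_convergence
      (fun r => ‖(((α - a) / r - t * r) * gaussian α t r) • u r‖)
      (fun N => ?_) hDu.norm (fun N => Eventually.of_forall fun r => ?_)
      (Eventually.of_forall fun r => ?_)
    · simp_rw [mul_smul (logBump _)]
      exact (measurable_logBump_log _).aestronglyMeasurable.smul hDu.1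
    · rw [mul_smul, norm_smul]
      exact mul_le_of_le_one_left (norm_nonneg _) (abs_logBump_le _)
    · simp_rw [mul_smul (logBump _)]
      simpa using (tendsto_logBump (Real.log r)).smul_const
        ((((α - a) / r - t * r) * gaussian α t r) • u r)
  have hlim3 := (tendsto_integral_deriv_logBump hn hν ht hu).neg.sub hlim2
  rw [neg_zero, zero_sub] at hlim3
  have hfin := tendsto_nhds_unique hlim1 (hlim3.congr fun N => (hstep N).symm)
  have e0 := integral_radial_gaussian_mul hn ν t (fun _ => 1) w
  simp only [one_mul] at e0
  rw [e0, hfin, ← integral_radial_gaussian_mul hn ν t (fun r => (α - a) / r - t * r) u]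

end IntegrationByParts

/-! ### Diagonalization of the radial Dirac operator. -/

section Dirac

variable {n : ℕ} {ν : Fin 2 → ℝ} {s m : ℝ}

/-- The amplitudes are eigenvectors of the symbol of the radial Dirac operator. -/
lemma energy_mul_star_amplitude (hm : 0 < m) (hs : s ^ 2 = 1) {E : ℝ} (hE : m < |E|) (b : Fin 2) :
    (E : ℂ) * star (amplitude s m E b) = ((![m, -m] b : ℝ) : ℂ) * star (amplitude s m E b) -
      Complex.I * ((![s, -s] b * momentum m E : ℝ) : ℂ) * star (amplitude s m E b.rev) := by
  have h0 := ne_zero_of_lt_abs hm hE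
  have hp := abs_mul_normPlus_mul_normMinus hm hE
  have hpos : 0 < |E| * (normPlus m E * normMinus m E) := by
    rw [hp]; exact half_pos (momentum_pos hm hE)
  have hP : normPlus m E ≠ 0 := fun h => by simp [h] at hpos
  have hM : normMinus m E ≠ 0 := fun h => by simp [h] at hpos
  -- Writing `p = 2|E| N⁺ N⁻` removes the square root of `E² - m²`; the eigenvalue equations then
  -- only involve the squares of `N⁺` and `N⁻`.
  have hpE : momentum m E = 2 * (E * Real.sign E) * (normPlus m E * normMinus m E) := by
    have : E * Real.sign E = |E| := by
      rcases h0.lt_or_gt with h | h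
      · simp [Real.sign_of_neg h, abs_of_neg h]
      · simp [Real.sign_of_pos h, abs_of_pos h]
    rw [this]; linarith
  have hsg := sign_sq h0
  have h1 : (E - m) * normPlus m E = Real.sign E * momentum m E * normMinus m E := by
    have e : Real.sign E * momentum m E * normMinus m E =
        2 * E * Real.sign E ^ 2 * normPlus m E * normMinus m E ^ 2 := by rw [hpE]; ring
    rw [e, hsg, normMinus_sq hm hE]; field_simp
  have h2 : (E + m) * Real.sign E * normMinus m E = momentum m E * normPlus m E := by
    have e : momentum m E * normPlus m E =
        2 * E * Real.sign E * normMinus m E * normPlus m E ^ 2 := by rw [hpE]; ring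
    rw [e, normPlus_sq hm hE]; field_simp
  have h1C := congrArg Complex.ofReal h1
  have h2C := congrArg Complex.ofReal h2
  have hsC := congrArg Complex.ofReal hs
  push_cast at h1C h2C hsC
  fin_cases b
  · simp [amplitude, Fin.rev]
    linear_combination h1C + (Complex.I ^ 2 * Real.sign E * momentum m E * normMinus m E) * hsC +
      (Real.sign E * momentum m E * normMinus m E : ℂ) * Complex.I_sq
  · simp [amplitude, Fin.rev]
    linear_combination (Complex.I * s) * h2C

lemma eq_of_forall_inner_energyGaussian (hm : 0 < m) (hs : s ^ 2 = 1) (hν : ∀ b, 0 ≤ ν b)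
    {φ χ : EnergyL2 m} (h : ∀ b t (ht : 0 < t), inner ℂ (energyGaussian hm hs hν b ht) φ =
      inner ℂ (energyGaussian hm hs hν b ht) χ) : φ = χ := by
  rw [← sub_eq_zero]
  refine energyL2_eq_zero hm hs hν fun b t ht => ?_
  have h1 := h b t⁻¹ (inv_pos.2 ht)
  rw [← sub_eq_zero, ← inner_sub_right, inner_energyGaussian, inv_inv, mul_eq_zero,
    Complex.ofReal_eq_zero] at h1
  exact h1.resolve_left (Real.rpow_pos_of_pos (inv_pos.2 ht) _).ne'

/-- The transform of `(2(ν+1) - t r²) r^ν exp(-t r²/2)`. -/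
lemma integral_ladder (hn : 1 ≤ n) (hm : 0 < m) (hs : s ^ 2 = 1) (hν : ∀ b, 0 ≤ ν b)
    {P : RadialL2 n ≃ₗᵢ[ℂ] EnergyL2 m}
    (hP : ∀ b t, 0 < t → ∀ f : RadialL2 n,
      ∫ r, (gaussian (radialExp n (ν b)) t r : ℂ) * f r b ∂(radialMeasure n) =
        ((t ^ (-ν b - 1) : ℝ) : ℂ) * ∫ E, star (amplitude s m E b) *
          ((gaussian (ν b) t⁻¹ (momentum m E) : ℂ) * P f E) ∂(energyMeasure m))
    (b : Fin 2) {t : ℝ} (ht : 0 < t) (f : RadialL2 n) :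
    ∫ r, (2 * (ν b + 1) * gaussian (radialExp n (ν b)) t r -
        t * gaussian (radialExp n (ν b) + 2) t r : ℂ) * f r b ∂(radialMeasure n) =
      ((t ^ (-(ν b + 1) - 1) : ℝ) : ℂ) * ∫ E, star (amplitude s m E b) *
          ((gaussian (ν b + 2) t⁻¹ (momentum m E) : ℂ) * P f E) ∂(energyMeasure m) := by
  set q := radialExp n (ν b) with hq
  have hqn : 2 * q + n = 2 * ν b + 2 := by rw [hq, radialExp]; ring
  set w : ℝ → ℂ := fun r => 2 * (ν b + 1) * gaussian q t r - t * gaussian (q + 2) t r with hw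
  have hwL : MemLp w 2 (radialMeasure n) := by
    have h1 := memLp_two_of_gaussian_sq (q := q) hn (by linarith [hν b]) ht
    have h2 := memLp_two_of_gaussian_sq (q := q + 2) hn (by linarith [hν b]) ht
    exact (h1.const_mul (2 * (ν b + 1) : ℂ)).sub (h2.const_mul (t : ℂ))
  set W : RadialL2 n := (memLp_single hwL b).toLp _ with hW
  have hE2 := (memLp_energyGaussian hm hs b (a := ν b + 2) (by linarith [hν b])
    (inv_pos.2 ht)).const_mul ((t ^ (-(ν b + 1) - 1) : ℝ) : ℂ)
  set W' : EnergyL2 m := hE2.toLp _ with hW'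
  -- Totality reduces this to pairings with the energy Gaussians. For `P W` they are radial
  -- integrals by `hP`; for `W'` they come from folding.
  have hPW : P W = W' := by
    refine eq_of_forall_inner_energyGaussian hm hs hν fun c u hu => ?_
    have e1 : inner ℂ (energyGaussian hm hs hν c hu) (P W) =
        if c = b then (u * gaussMoment (ν b + 1) (u + t) : ℂ) else 0 := by
      rw [inner_energyGaussian, ← hP c u hu]
      have : (fun r => (gaussian (radialExp n (ν c)) u r : ℂ) * W r c) =ᵐ[radialMeasure n]
          fun r => if c = b then 2 * (ν b + 1) * ((gaussian q u r : ℂ) * gaussian q t r) -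
            t * ((gaussian q u r : ℂ) * gaussian (q + 2) t r) else 0 := by
        filter_upwards [(memLp_single hwL b).coeFn_toLp] with r hr
        rw [hW, hr, PiLp.single_apply]
        split_ifs with h
        · rw [h, hw]; ring
        · simp
      rw [integral_congr_ae this]
      split_ifs with h
      · rw [integral_sub, integral_const_mul, integral_const_mul,
          integral_gaussian_mul_gaussian hn (ν₀ := ν b) (by linarith [hν b]) hu ht (by linarith),
          integral_gaussian_mul_gaussian hn (ν₀ := ν b + 1) (by linarith [hν b]) hu ht
            (by linarith)]
        -- The recurrence turns `2(ν+1)` times the moment of order `ν` into `u + t` times that of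
        -- order `ν + 1`; subtracting the `t` part leaves `u`.
        · have := gaussMoment_sub_one (ν := ν b + 1) (a := u + t) (by linarith [hν b])
            (add_pos hu ht)
          rw [add_sub_cancel_right] at this
          have hC := congrArg Complex.ofReal this
          push_cast at hC
          linear_combination hC
        · exact (integrable_gaussian_mul_gaussian hn hu ht (by linarith [hν b])).const_mul _
        · exact (integrable_gaussian_mul_gaussian hn hu ht (by linarith [hν b])).const_mul _
      · simp
    have e2 : inner ℂ (energyGaussian hm hs hν c hu) W' =
        if c = b then (u * gaussMoment (ν b + 1) (u + t) : ℂ) else 0 := by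
      rw [inner_energyGaussian]
      have : (fun E => star (amplitude s m E c) * ((gaussian (ν c) u⁻¹ (momentum m E) : ℂ) * W' E))
          =ᵐ[energyMeasure m] fun E => ((t ^ (-(ν b + 1) - 1) : ℝ) : ℂ) *
          (star (amplitude s m E c) * (amplitude s m E b *
          ((gaussian (ν c) u⁻¹ (momentum m E) : ℂ) * gaussian (ν b + 2) t⁻¹ (momentum m E)))) := by
        filter_upwards [hE2.coeFn_toLp] with E hE
        rw [hW', hE]; ring
      rw [integral_congr_ae this, integral_const_mul, integral_star_amplitude_mul hm hs c b
        (g := fun p => (gaussian (ν c) u⁻¹ p : ℂ) * gaussian (ν b + 2) t⁻¹ p)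
        (integrable_gaussian_mul_gaussian (by norm_num) (inv_pos.2 hu) (inv_pos.2 ht)
          (by push_cast; linarith [hν b, hν c]))]
      split_ifs with h
      · subst h
        rw [integral_gaussian_mul_gaussian (by norm_num) (ν₀ := ν c + 1) (by linarith [hν c])
          (inv_pos.2 hu) (inv_pos.2 ht) (by push_cast; ring), ← gaussMoment_inv_add_inv hu ht]
        have : u ^ (-ν c - 1) = u * u ^ (-(ν c + 1) - 1) := by
          rw [mul_comm, ← Real.rpow_add_one hu.ne']; congr 1; ring
        rw [this]
        push_cast; ring
      · simp
    rw [e1, e2]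
  have hin : inner ℂ W f = inner ℂ W' (P f) := by rw [← hPW, P.inner_map_map]
  rw [L2.inner_def, L2.inner_def] at hin
  rw [← integral_const_mul]
  refine (integral_congr_ae ?_).trans (hin.trans (integral_congr_ae ?_))
  · filter_upwards [(memLp_single hwL b).coeFn_toLp] with r hr
    rw [hW, hr, EuclideanSpace.inner_single_left, hw]
    simp only [map_sub, map_mul, map_add, map_one, map_ofNat, Complex.conj_ofReal]
  · filter_upwards [hE2.coeFn_toLp] with E hE
    rw [hW', hE, RCLike.inner_apply, map_mul, map_mul, Complex.conj_ofReal, Complex.conj_ofReal]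
    simp only [starRingEnd_apply]; ring

lemma memLp_apply (f : RadialL2 n) (b : Fin 2) : MemLp (fun r => f r b) 2 (radialMeasure n) :=
  (Lp.memLp f).eval_piLp b

/-- The off-diagonal part of the Dirac operator applied to a Gaussian. -/
lemma integral_offDiag (hn : 1 ≤ n) (hm : 0 < m) (hs : s = 1 ∨ s = -1) (hν : ∀ b, 0 ≤ ν b)
    (hgap : ∀ b : Fin 2, ν b.rev = ν b + ![s, -s] b)
    {P : RadialL2 n ≃ₗᵢ[ℂ] EnergyL2 m}
    (hP : ∀ b t, 0 < t → ∀ f : RadialL2 n,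
      ∫ r, (gaussian (radialExp n (ν b)) t r : ℂ) * f r b ∂(radialMeasure n) =
        ((t ^ (-ν b - 1) : ℝ) : ℂ) * ∫ E, star (amplitude s m E b) *
          ((gaussian (ν b) t⁻¹ (momentum m E) : ℂ) * P f E) ∂(energyMeasure m))
    (b : Fin 2) {t : ℝ} (ht : 0 < t) (f : RadialL2 n) :
    ∫ r, (((((1 - ![s, -s] b) * ν b) / r - t * r) * gaussian (radialExp n (ν b)) t r : ℝ) : ℂ) *
        f r b.rev ∂(radialMeasure n) =
      -((![s, -s] b * t ^ (-ν b - 1) : ℝ) : ℂ) * ∫ E, star (amplitude s m E b.rev) *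
        ((gaussian (ν b + 1) t⁻¹ (momentum m E) : ℂ) * P f E) ∂(energyMeasure m) := by
  have hs2 : s ^ 2 = 1 := by rcases hs with h | h <;> rw [h] <;> norm_num
  have hσ : ![s, -s] b = 1 ∨ ![s, -s] b = -1 := by
    fin_cases b <;> rcases hs with h | h <;> simp [h]
  have hg := hgap b
  generalize ![s, -s] b = σ at hσ hg ⊢
  have hup : ∀ {r : ℝ} (a : ℝ), 0 < r → r * gaussian a t r = gaussian (a + 1) t r := by
    intro r a hr
    nth_rw 1 [← Real.rpow_one r]; rw [rpow_mul_gaussian hr, add_comm]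
  rcases hσ with h | h
  -- When the other order is `ν + 1` the `1/r` term cancels, and `r · r^ν` is already the Gaussian
  -- of that order.
  · subst h
    have hq : radialExp n (ν b.rev) = radialExp n (ν b) + 1 := by
      unfold radialExp; rw [hg]; ring
    have hl : (fun r => (((((1 - 1) * ν b) / r - t * r) * gaussian (radialExp n (ν b)) t r : ℝ) : ℂ) *
        f r b.rev) =ᵐ[radialMeasure n] fun r => (-t : ℂ) *
          ((gaussian (radialExp n (ν b.rev)) t r : ℂ) * f r b.rev) := by
      filter_upwards [ae_radialMeasure_pos] with r hr
      rw [hq, ← hup _ hr]; push_cast; ring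
    rw [integral_congr_ae hl, integral_const_mul, hP b.rev t ht f, hg]
    have : t ^ (-ν b - 1) = t * t ^ (-(ν b + 1) - 1) := by
      rw [mul_comm, ← Real.rpow_add_one ht.ne']; congr 1; ring
    rw [this]; push_cast; ring
  -- When the other order is `ν - 1` the integrand is the combination treated in `integral_ladder`,
  -- taken at the lower order.
  · subst h
    have hνb : ν b = ν b.rev + 1 := by linarith
    have hq : radialExp n (ν b) = radialExp n (ν b.rev) + 1 := by
      unfold radialExp; rw [hνb]; ring
    have hl : (fun r => (((((1 - -1) * ν b) / r - t * r) * gaussian (radialExp n (ν b)) t r : ℝ) : ℂ) *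
        f r b.rev) =ᵐ[radialMeasure n] fun r =>
          (2 * (ν b.rev + 1) * gaussian (radialExp n (ν b.rev)) t r -
            t * gaussian (radialExp n (ν b.rev) + 2) t r : ℂ) * f r b.rev := by
      filter_upwards [ae_radialMeasure_pos] with r hr
      congr 1
      have e : gaussian (radialExp n (ν b.rev) + 2) t r =
          r * (r * gaussian (radialExp n (ν b.rev)) t r) := by
        rw [hup _ hr, hup _ hr]; congr 1; ring
      rw [hq, e, ← hup _ hr, hνb]
      have : ((1 - -1) * (ν b.rev + 1) / r - t * r) *
          (r * gaussian (radialExp n (ν b.rev)) t r) = 2 * (ν b.rev + 1) *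
          gaussian (radialExp n (ν b.rev)) t r -
            t * (r * (r * gaussian (radialExp n (ν b.rev)) t r)) := by
        field_simp; ring
      rw [this]; push_cast; ring
    rw [integral_congr_ae hl, integral_ladder hn hm hs2 hν hP b.rev ht f, ← hνb,
      show ν b.rev + 2 = ν b + 1 by linarith]
    push_cast; ring

/-- The transform diagonalizes the radial Dirac operator on its maximal domain. -/
theorem transform_dirac_ae_eq (hn : 1 ≤ n) (hm : 0 < m) (hs : s = 1 ∨ s = -1)
    (hν : ∀ b, 0 ≤ ν b) (hgap : ∀ b : Fin 2, ν b.rev = ν b + ![s, -s] b)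
    {P : RadialL2 n ≃ₗᵢ[ℂ] EnergyL2 m}
    (hP : ∀ b t, 0 < t → ∀ f : RadialL2 n,
      ∫ r, (gaussian (radialExp n (ν b)) t r : ℂ) * f r b ∂(radialMeasure n) =
        ((t ^ (-ν b - 1) : ℝ) : ℂ) * ∫ E, star (amplitude s m E b) *
          ((gaussian (ν b) t⁻¹ (momentum m E) : ℂ) * P f E) ∂(energyMeasure m))
    {f g : RadialL2 n}
    (hd : ∀ b : Fin 2, ∃ v, HasWeakDeriv (fun r => f r b.rev) v ∧
      ∀ᵐ r ∂(radialMeasure n), g r b = ((![m, -m] b : ℝ) : ℂ) * f r b - Complex.I *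
        (v r + (((ν b + n / 2 - (1 - ![s, -s] b) * ν b) / r : ℝ) : ℂ) * f r b.rev)) :
    ∀ᵐ E ∂(energyMeasure m), P g E = (E : ℂ) * P f E := by
  have hs2 : s ^ 2 = 1 := by rcases hs with h | h <;> rw [h] <;> norm_num
  have hradial : ∀ b t, 0 < t →
      ∫ r, (gaussian (radialExp n (ν b)) t r : ℂ) * g r b ∂(radialMeasure n) =
      ((![m, -m] b : ℝ) : ℂ) *
        (∫ r, (gaussian (radialExp n (ν b)) t r : ℂ) * f r b ∂(radialMeasure n)) +
      Complex.I * ∫ r, (((((1 - ![s, -s] b) * ν b) / r - t * r) *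
        gaussian (radialExp n (ν b)) t r : ℝ) : ℂ) * f r b.rev ∂(radialMeasure n) := by
    intro b t ht
    obtain ⟨v, hv, hgv⟩ := hd b
    set a := ν b + n / 2 - (1 - ![s, -s] b) * ν b with ha
    have hw : MemLp (fun r => v r + ((a / r : ℝ) : ℂ) * f r b.rev) 2 (radialMeasure n) := by
      refine (((memLp_apply g b).sub ((memLp_apply f b).const_mul
        ((![m, -m] b : ℝ) : ℂ))).const_mul Complex.I).ae_eq ?_
      filter_upwards [hgv] with r hr
      simp only [Pi.sub_apply, hr]
      linear_combination (-(v r + ((a / r : ℝ) : ℂ) * f r b.rev)) * Complex.I_sq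
    -- If `ν b = 0` then `a` equals `ν b + n / 2`; otherwise `ν b > 0`. These are the two admissible
    -- cases.
    have hparts := integral_gaussian_mul_weakDeriv hn hv (hν b) ht (a := a)
      ((hν b).eq_or_lt.imp_left fun h => by rw [ha, ← h]; ring) (memLp_apply f b.rev) hw
    rw [show ν b + n / 2 - a = (1 - ![s, -s] b) * ν b by rw [ha]; ring] at hparts
    have hGw : Integrable (fun r => (gaussian (radialExp n (ν b)) t r : ℂ) *
        (v r + ((a / r : ℝ) : ℂ) * f r b.rev)) (radialMeasure n) :=
      (memLp_two_of_gaussian_sq hn (by unfold radialExp; linarith [hν b]) ht).integrable_mul hw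
    have hl : (fun r => (gaussian (radialExp n (ν b)) t r : ℂ) * g r b) =ᵐ[radialMeasure n]
        fun r => ((![m, -m] b : ℝ) : ℂ) * ((gaussian (radialExp n (ν b)) t r : ℂ) * f r b) -
          Complex.I * ((gaussian (radialExp n (ν b)) t r : ℂ) *
            (v r + ((a / r : ℝ) : ℂ) * f r b.rev)) := by
      filter_upwards [hgv] with r hr
      rw [hr]; ring
    rw [integral_congr_ae hl, integral_sub
      ((integrable_gaussian_mul_apply hn hν b ht f).const_mul _) (hGw.const_mul _),
      integral_const_mul, integral_const_mul, hparts]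
    ring
  have hEint : ∀ b t, 0 < t → Integrable (fun E => star (amplitude s m E b) *
      ((gaussian (ν b) t (momentum m E) : ℂ) * ((E : ℂ) * P f E))) (energyMeasure m) ∧
      ∫ E, star (amplitude s m E b) * ((gaussian (ν b) t (momentum m E) : ℂ) * ((E : ℂ) * P f E))
        ∂(energyMeasure m) = ((![m, -m] b : ℝ) : ℂ) * (∫ E, star (amplitude s m E b) *
          ((gaussian (ν b) t (momentum m E) : ℂ) * P f E) ∂(energyMeasure m)) -
        Complex.I * ((![s, -s] b : ℝ) : ℂ) * ∫ E, star (amplitude s m E b.rev) *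
          ((gaussian (ν b + 1) t (momentum m E) : ℂ) * P f E) ∂(energyMeasure m) := by
    intro b t ht
    have i1 := integrable_star_amplitude_mul hm hs2 b
      (integrable_gaussian_momentum_mul hm (P f) (a := ν b) (by linarith [hν b]) ht)
    have i2 := integrable_star_amplitude_mul hm hs2 b.rev
      (integrable_gaussian_momentum_mul hm (P f) (a := ν b + 1) (by linarith [hν b]) ht)
    have hl : (fun E => star (amplitude s m E b) * ((gaussian (ν b) t (momentum m E) : ℂ) *
        ((E : ℂ) * P f E))) =ᵐ[energyMeasure m] fun E => ((![m, -m] b : ℝ) : ℂ) *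
        (star (amplitude s m E b) * ((gaussian (ν b) t (momentum m E) : ℂ) * P f E)) -
        Complex.I * ((![s, -s] b : ℝ) : ℂ) * (star (amplitude s m E b.rev) *
          ((gaussian (ν b + 1) t (momentum m E) : ℂ) * P f E)) := by
      filter_upwards [ae_energyMeasure_lt_abs] with E hE
      have hp := momentum_pos hm hE
      have e : gaussian (ν b + 1) t (momentum m E) =
          momentum m E * gaussian (ν b) t (momentum m E) := by
        nth_rw 2 [← Real.rpow_one (momentum m E)]; rw [rpow_mul_gaussian hp, add_comm]
      have h := energy_mul_star_amplitude hm hs2 hE b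
      rw [e]
      push_cast at h ⊢
      linear_combination (gaussian (ν b) t (momentum m E) * P f E : ℂ) * h
    refine ⟨((i1.const_mul _).sub (i2.const_mul _)).congr hl.symm, ?_⟩
    rw [integral_congr_ae hl, integral_sub (i1.const_mul _) (i2.const_mul _), integral_const_mul,
      integral_const_mul]
  have hval : ∀ b t, 0 < t → ∫ E, star (amplitude s m E b) *
      ((gaussian (ν b) t (momentum m E) : ℂ) * P g E) ∂(energyMeasure m) =
      ∫ E, star (amplitude s m E b) * ((gaussian (ν b) t (momentum m E) : ℂ) *
        ((E : ℂ) * P f E)) ∂(energyMeasure m) := by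
    intro b t ht
    have ht' := inv_pos.2 ht
    have h1 := hradial b t⁻¹ ht'
    rw [hP b _ ht' g, hP b _ ht' f, integral_offDiag hn hm hs hν hgap hP b ht' f, inv_inv] at h1
    have hne : ((t⁻¹ ^ (-ν b - 1) : ℝ) : ℂ) ≠ 0 :=
      Complex.ofReal_ne_zero.2 (Real.rpow_pos_of_pos ht' _).ne'
    rw [(hEint b t ht).2]
    refine mul_left_cancel₀ hne (h1.trans ?_)
    push_cast; ring
  have hPg : ∀ b t, 0 < t → Integrable (fun E => star (amplitude s m E b) *
      ((gaussian (ν b) t (momentum m E) : ℂ) * P g E)) (energyMeasure m) := fun b t ht =>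
    integrable_star_amplitude_gaussian_mul hm hs2 hν b ht _
  have hmeas : ∀ h : EnergyL2 m, Measurable h := fun h => (Lp.stronglyMeasurable h).measurable
  -- At this point `E * P f` is not known to be square integrable, so the comparison uses the
  -- uniqueness result for measurable functions rather than totality in `L²`.
  have := ae_eq_zero_of_integral_star_amplitude hm hs2 (ν := ν) (t₀ := 1)
    (φ := fun E => P g E - (E : ℂ) * P f E)
    ((hmeas _).sub (Complex.measurable_ofReal.mul (hmeas _)))
    (fun b t ht => by
      simp_rw [mul_sub]
      exact (hPg b t (by linarith)).sub (hEint b t (by linarith)).1)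
    (fun b t ht => by
      simp_rw [mul_sub]
      rw [integral_sub (hPg b t (by linarith)) (hEint b t (by linarith)).1,
        hval b t (by linarith), sub_self])
  filter_upwards [this] with E hE
  exact sub_eq_zero.1 hE

end Dirac

/-! ### Specialization to the partial waves in dimensions two and three. -/

section PartialWaves

/-- The orders of the upper and of the lower Bessel function. -/
def order (n : ℕ) (k : ℤ) : Fin 2 → ℝ := ![upperOrder n k, lowerOrder n k]

/-- The difference `s` of the orders. -/
def orderGap (n : ℕ) (k : ℤ) : ℝ := lowerOrder n k - upperOrder n k

variable {n : ℕ} {k : ℤ} {m : ℝ}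

lemma upperWave_eq (E r : ℝ) :
    upperWave n k m E r = wave n (order n k) (orderGap n k) m 0 E r := by
  simp only [upperWave, wave, amplitude, order, Matrix.cons_val_zero]
  push_cast; ring

lemma lowerWave_eq (E r : ℝ) :
    lowerWave n k m E r = wave n (order n k) (orderGap n k) m 1 E r := by
  simp only [lowerWave, wave, amplitude, order, orderGap, Matrix.cons_val_one,
    Matrix.cons_val_fin_one]
  push_cast; ring

lemma order_rev (b : Fin 2) :
    order n k b.rev = order n k b + ![orderGap n k, -orderGap n k] b := by
  fin_cases b <;> simp [order, orderGap, Fin.rev]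

lemma orderGap_eq (hn : n = 2 ∨ n = 3) : orderGap n k = 1 ∨ orderGap n k = -1 := by
  rcases hn with rfl | rfl <;> by_cases h : 0 ≤ k <;>
    simp [orderGap, upperOrder, lowerOrder, sgnIdx, h]
  · right; ring
  · left; ring

/-- This is where `k = 0` is excluded for `n = 3`: the lower order would be `-1/2`. -/
lemma order_nonneg (hn : n = 2 ∨ n = 3) (hk : n = 3 → k ≠ 0) (b : Fin 2) : 0 ≤ order n k b := by
  rcases hn with rfl | rfl <;> by_cases h : 0 ≤ k
  · have : (0 : ℝ) ≤ k := by exact_mod_cast h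
    fin_cases b <;> simp [order, upperOrder, lowerOrder, sgnIdx, h]
    positivity
  · have : (k : ℝ) ≤ -1 := by exact_mod_cast (by omega : k ≤ -1)
    fin_cases b <;> simp [order, upperOrder, lowerOrder, sgnIdx, h]
    rw [abs_of_nonpos (by linarith)]; linarith
  · have : (1 : ℝ) ≤ k := by
      have := hk rfl
      exact_mod_cast (by omega : 1 ≤ k)
    fin_cases b <;> simp [order, upperOrder, lowerOrder, sgnIdx, h]
    · positivity
    · rw [abs_of_nonneg (by linarith)]; linarith
  · have : (k : ℝ) ≤ -1 := by exact_mod_cast (by omega : k ≤ -1)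
    fin_cases b <;> simp [order, upperOrder, lowerOrder, sgnIdx, h] <;>
      rw [abs_of_nonpos (by linarith)] <;> linarith

/-- With `ν` the upper order, the coefficient is `n/2 + ν` for gap `1` and `n/2 - ν` for gap `-1`,
the form in which integration by parts handles both dimensions at once. -/
lemma lowerToUpper_eq (hn : n = 2 ∨ n = 3) : lowerToUpper n k =
    ((order n k 0 + n / 2 - (1 - orderGap n k) * order n k 0 : ℝ) : ℂ) := by
  rcases hn with rfl | rfl <;> by_cases h : 0 ≤ k
  · have : (0 : ℝ) ≤ k := by exact_mod_cast h
    simp [lowerToUpper, order, orderGap, upperOrder, lowerOrder, sgnIdx, h, abs_of_nonneg this]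
  · have : (k : ℝ) ≤ 0 := by exact_mod_cast (by omega : k ≤ 0)
    simp [lowerToUpper, order, orderGap, upperOrder, lowerOrder, sgnIdx, h, abs_of_nonpos this]
    ring
  · have : (0 : ℝ) ≤ k := by exact_mod_cast h
    simp [lowerToUpper, order, orderGap, upperOrder, lowerOrder, sgnIdx, h, abs_of_nonneg this]
    ring
  · have : (k : ℝ) ≤ 0 := by exact_mod_cast (by omega : k ≤ 0)
    simp [lowerToUpper, order, orderGap, upperOrder, lowerOrder, sgnIdx, h, abs_of_nonpos this]
    ring

lemma upperToLower_eq (hn : n = 2 ∨ n = 3) : upperToLower n k =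
    ((order n k 1 + n / 2 - (1 - -orderGap n k) * order n k 1 : ℝ) : ℂ) := by
  rcases hn with rfl | rfl <;> by_cases h : 0 ≤ k
  · have : (0 : ℝ) ≤ k := by exact_mod_cast h
    simp [upperToLower, order, orderGap, upperOrder, lowerOrder, sgnIdx, h, abs_of_nonneg this]
    ring
  · have : (k : ℝ) ≤ 0 := by exact_mod_cast (by omega : k ≤ 0)
    simp [upperToLower, order, orderGap, upperOrder, lowerOrder, sgnIdx, h, abs_of_nonpos this]
  · have : (0 : ℝ) ≤ k := by exact_mod_cast h
    simp [upperToLower, order, orderGap, upperOrder, lowerOrder, sgnIdx, h, abs_of_nonneg this]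
    ring
  · have : (k : ℝ) ≤ 0 := by exact_mod_cast (by omega : k ≤ 0)
    simp [upperToLower, order, orderGap, upperOrder, lowerOrder, sgnIdx, h, abs_of_nonpos this]
    ring

lemma integrand_eq (f : ℝ → EuclideanSpace ℂ (Fin 2)) (E r : ℝ) :
    integrand n k m f E r = ∑ b, wave n (order n k) (orderGap n k) m b E r * f r b := by
  rw [integrand, upperWave_eq, lowerWave_eq, Fin.sum_univ_two]

lemma truncTransform_eq (R : ℝ) (f : ℝ → EuclideanSpace ℂ (Fin 2)) :
    truncTransform n k m R f = truncWave n (order n k) (orderGap n k) m R f := by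
  ext E
  simp only [truncTransform, truncWave, integrand_eq]

lemma invIntegrand_apply (φ : ℝ → ℂ) (r E : ℝ) (b : Fin 2) :
    invIntegrand n k m φ r E b = star (wave n (order n k) (orderGap n k) m b E r) * φ E := by
  fin_cases b
  · simp [invIntegrand, upperWave_eq]
  · simp [invIntegrand, lowerWave_eq]

/-- A spinor and its image under the radial Dirac operator, componentwise. -/
lemma IsRadialDirac.components (hn : n = 2 ∨ n = 3) {f g : RadialL2 n}
    (h : IsRadialDirac n k m f g) (b : Fin 2) : ∃ v, HasWeakDeriv (fun r => f r b.rev) v ∧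
      ∀ᵐ r ∂(radialMeasure n), g r b = ((![m, -m] b : ℝ) : ℂ) * f r b - Complex.I *
        (v r + (((order n k b + n / 2 - (1 - ![orderGap n k, -orderGap n k] b) * order n k b) / r :
          ℝ) : ℂ) * f r b.rev) := by
  obtain ⟨u, v, hu, hv, hg⟩ := h
  fin_cases b
  · refine ⟨v, hv, ?_⟩
    filter_upwards [hg] with r hr
    rw [lowerToUpper_eq hn] at hr
    simp only [Fin.zero_eta, Matrix.cons_val_zero, Complex.ofReal_div]
    exact hr.1
  · refine ⟨u, hu, ?_⟩
    filter_upwards [hg] with r hr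
    rw [upperToLower_eq hn] at hr
    simp only [Fin.mk_one, Matrix.cons_val_one, Matrix.cons_val_fin_one, Complex.ofReal_div]
    refine hr.2.trans ?_
    rw [Complex.ofReal_neg]
    have : Fin.rev (1 : Fin 2) = 0 := rfl
    rw [this]
    ring

end PartialWaves

end RelHankel

end

/-! ### The proposition. -/

theorem proposition2p1 (n : ℕ) (hn : n = 2 ∨ n = 3) (k : ℤ) (hk : n = 3 → k ≠ 0)
    (m : ℝ) (hm : 0 < m) :
    ∃ P : RadialL2 n ≃ₗᵢ[ℂ] EnergyL2 m,
      (∀ f : RadialL2 n,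
        (∀ R E : ℝ, m < |E| →
          IntegrableOn (integrand n k m f E) (Ioc 0 R) (radialMeasure n)) ∧
        (∀ R : ℝ, MemLp (truncTransform n k m R f) 2 (energyMeasure m)) ∧
        Tendsto (fun R : ℝ =>
          eLpNorm (fun E => truncTransform n k m R f E - P f E) 2 (energyMeasure m))
          atTop (𝓝 0)) ∧
      (∀ φ : EnergyL2 m,
        (∀ R r : ℝ, 0 < r →
          IntegrableOn (invIntegrand n k m φ r) (Icc (-R) R) (energyMeasure m)) ∧
        (∀ R : ℝ, MemLp (truncInverse n k m R φ) 2 (radialMeasure n)) ∧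
        Tendsto (fun R : ℝ =>
          eLpNorm (fun r => truncInverse n k m R φ r - P.symm φ r) 2 (radialMeasure n))
          atTop (𝓝 0)) ∧
      (∀ f g : RadialL2 n, IsRadialDirac n k m f g →
        ∀ᵐ E ∂(energyMeasure m), P g E = (E : ℂ) * P f E) := by
  have hn1 : 1 ≤ n := by omega
  have hs := orderGap_eq (k := k) hn
  have hs2 : orderGap n k ^ 2 = 1 := by rcases hs with h | h <;> rw [h] <;> norm_num
  have hν := order_nonneg hn hk
  obtain ⟨P, hP⟩ := exists_unitary hn1 hm hs2 hν
  refine ⟨P, fun f => ?_, fun φ => ?_, fun f g hfg => ?_⟩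
  · have hT : ∀ R, truncTransform n k m R f =ᵐ[energyMeasure m]
        P (truncLp measurableSet_Ioc (S := Ioc 0 R) f) := fun R => by
      rw [truncTransform_eq]
      exact truncWave_ae_eq hn1 hm hs2 hν hP f R
    refine ⟨fun R E hE => ?_, fun R => (Lp.memLp _).ae_eq (hT R).symm, ?_⟩
    · simp_rw [funext (integrand_eq (n := n) (k := k) (m := m) f E)]
      exact integrable_finsetSum _ fun b _ => integrableOn_wave_mul hn1 hm hs2 hν f hE R b
    · refine tendsto_eLpNorm_sub_of_ae_eq_trunc P.toLinearIsometry f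
        (fun R => measurableSet_Ioc) ?_ hT
      filter_upwards [ae_radialMeasure_pos] with r hr
      filter_upwards [eventually_ge_atTop r] with R hR using ⟨hr, hR⟩
  · have hI : ∀ R r : ℝ, 0 < r → ∀ b, IntegrableOn (fun E => invIntegrand n k m φ r E b)
        (Icc (-R) R) (energyMeasure m) := fun R r hr b => by
      simp_rw [invIntegrand_apply]
      exact integrableOn_star_wave_mul hm hs2 hν φ hr R b
    have hT : ∀ R, truncInverse n k m R φ =ᵐ[radialMeasure n]
        P.symm (truncLp measurableSet_Icc (S := Icc (-R) R) φ) := fun R => by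
      filter_upwards [ae_radialMeasure_pos, ae_all_iff.2
        (integral_star_wave_mul_ae_eq hn1 hm hs2 hν hP φ R)] with r hr h
      ext b
      rw [← h b, truncInverse, eval_integral_piLp (hI R r hr)]
      simp_rw [invIntegrand_apply]
    refine ⟨fun R r hr => Integrable.of_eval_piLp (hI R r hr),
      fun R => (Lp.memLp _).ae_eq (hT R).symm, ?_⟩
    refine tendsto_eLpNorm_sub_of_ae_eq_trunc P.symm.toLinearIsometry φ
      (fun R => measurableSet_Icc) (Eventually.of_forall fun E => ?_) hT
    filter_upwards [eventually_ge_atTop |E|] with R hR using abs_le.1 hR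
  · exact transform_dirac_ae_eq hn1 hm hs hν order_rev hP (hfg.components hn)
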